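/- \textbf{Theorem (Persistence--Spanier correspondence).} Let $X$ be a geodesic metric space (any two points $x,y$ are the endpoints of an isometrically embedded copy of $[0,d(x,y)]$), let $\bullet\in X$ be a basepoint and let $G$ be an Abelian group. For $r>0$ let $\mathrm{Rips}(X,r)$ be the (geometric realization of the) simplicial complex with vertex set $X$ whose simplices are the nonempty finite subsets of $X$ of diameter $<r$; for $p<q$ let $i_{p,q}\colon \mathrm{Rips}(X,p)\to\mathrm{Rips}(X,q)$ be the inclusion. Let $\mathcal S(X,r,\pi_1)\le\pi_1(X,\bullet)$ be the subgroup generated by the classes of all loops $\alpha*\beta*\alpha^-$, where $\alpha$ is a path starting at $\bullet$ and $\beta$ is a loop based at the endpoint of $\alpha$ and contained in a closed ball of some radius $d<r$; this subgroup is normal. Let $\mathcal S(X,r,G)\le H_1(X;G)$ be the subgroup generated by the classes $g\cdot[\beta]$, where $g\in G$ and $\beta$ is a loop contained in a closed ball of some radius $d<r$. An $r$-sample of a loop $\alpha\colon[0,1]\to X$ is a choice of $0\le t_0<t_1<\dots<t_m\le 1$ such that $\mathrm{Diam}\,\alpha([t_i,t_{i+1}])<r$ for $0\le i<m$ and $\mathrm{Diam}\,\alpha([0,t_0]\cup[t_m,1])<r$,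 together with the induced edge loop in $\mathrm{Rips}(X,r)$ through the vertices $\alpha(t_0),\dots,\alpha(t_m),\alpha(t_0)$. For loops based at $\bullet$ one requires $t_0=0$. \begin{enumerate} \item There are group isomorphisms $$\pi_1(X,\bullet)/\mathcal S(X,3r/2,\pi_1)\;\cong\;\pi_1(\mathrm{Rips}(X,r),\bullet)\qquad (r>0)$$ which send the class of each loop $\alpha$ based at $\bullet$ to the class of each of its $r$-samples with $t_0=0$, and which, for all $0<p<q$, commute with the homomorphism induced by $i_{p,q}$ and the quotient map $\pi_1(X,\bullet)/\mathcal S(X,3p/2,\pi_1)\to\pi_1(X,\bullet)/\mathcal S(X,3q/2,\pi_1)$. \item There are group isomorphisms $$H_1(X;G)/\mathcal S(X,3r/2,G)\;\cong\;H_1(\mathrm{Rips}(X,r);G)\qquad (r>0)$$ which, for each loop $\alpha$ in $X$ and each $g\in G$, send the class of $g\cdot[\alpha]$ to $g\cdot[L]$ for each $r$-sample $L$ of $\alpha$, and which, for all $0<p<q$, commute with the homomorphism induced by $i_{p,q}$ and the quotient map $H_1(X;G)/\mathcal S(X,3p/2,G)\to H_1(X;G)/\mathcal S(X,3q/2,G)$.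 \end{enumerate} -/

import Mathlib

open CategoryTheory

universe u v

noncomputable section

namespace RipsSpanier

/-- A metric space is geodesic if any two points `x`, `y` are joined by an isometrically embedded
copy of the interval `[0, d(x, y)]`. -/
def IsGeodesicSpace (X : Type u) [MetricSpace X] : Prop :=
  ∀ x y : X, ∃ γ : Set.Icc (0 : ℝ) (dist x y) → X, Isometry γ ∧
    γ ⟨0, Set.left_mem_Icc.mpr dist_nonneg⟩ = x ∧
    γ ⟨dist x y, Set.right_mem_Icc.mpr dist_nonneg⟩ = y

/-! ### Geometric realization of an abstract simplicial complex -/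

section Realization

variable {V : Type u}

/-- The underlying set of the geometric realization of `K`: barycentric coordinates, that is,
nonnegative weights on the vertices which vanish outside some face and have total weight `1`. -/
def Realization (K : AbstractSimplicialComplex V) : Type u :=
  {w : V → ℝ // (∀ v, 0 ≤ w v) ∧ ∃ s ∈ K.faces, (∀ v, v ∉ s → w v = 0) ∧ ∑ v ∈ s, w v = 1}

namespace Realization

variable {K L : AbstractSimplicialComplex V}

open Classical in
/-- The inclusion of the closed simplex spanned by the face `s`. -/
def cell (s : K.faces) (w : stdSimplex ℝ (s : Finset V)) : Realization K :=
  ⟨fun v => if h : v ∈ (s : Finset V) then w.1 ⟨v, h⟩ else 0, by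
    refine ⟨fun v => ?_, s.1, s.2, fun v hv => dif_neg hv, ?_⟩
    · dsimp only
      split_ifs with h
      · exact w.2.1 _
      · exact le_rfl
    · rw [← Finset.sum_coe_sort, ← w.2.2]
      exact Finset.sum_congr rfl fun v _ => dif_pos v.2⟩

/-- The weak topology: a set is open if and only if its trace on every closed simplex is open. -/
instance : TopologicalSpace (Realization K) :=
  ⨆ s : K.faces, TopologicalSpace.coinduced (cell s) inferInstance

theorem continuous_cell (s : K.faces) : Continuous (cell s) :=
  continuous_iff_coinduced_le.mpr (le_iSup (fun s : K.faces =>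
    TopologicalSpace.coinduced (cell s) inferInstance) s)

/-- The continuous inclusion of realizations induced by an inclusion of simplicial complexes. -/
def incl (h : K ≤ L) : C(Realization K, Realization L) where
  toFun w := ⟨w.1, w.2.1, w.2.2.imp fun _ hs => ⟨h hs.1, hs.2⟩⟩
  continuous_toFun := by
    refine continuous_iSup_dom.mpr fun s => continuous_coinduced_dom.mpr ?_
    exact continuous_cell (K := L) ⟨s.1, h s.2⟩

open Classical in
/-- The point of the realization given by a vertex. -/
def vertex (K : AbstractSimplicialComplex V) (x : V) : Realization K :=
  ⟨fun v => if v = x then 1 else 0, fun v => by dsimp only; split_ifs <;> norm_num,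
    {x}, K.singleton_mem x, fun v hv => if_neg (by simpa using hv), by simp⟩

theorem incl_vertex (h : K ≤ L) (x : V) : incl h (vertex K x) = vertex L x := rfl

open Classical in
/-- The straight path `t ↦ (1 - t) x + t y` along the edge `{x, y}`
(a constant path if `x = y`). -/
def edge (K : AbstractSimplicialComplex V) {x y : V} (h : ({x, y} : Finset V) ∈ K.faces) :
    Path (vertex K x) (vertex K y) where
  toFun t := cell ⟨{x, y}, h⟩
    ⟨fun v => (1 - (t : ℝ)) * (if v.1 = x then 1 else 0) + t * (if v.1 = y then 1 else 0), by
      refine ⟨fun v => ?_, ?_⟩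
      · have h0 := t.2.1
        have h1 : 0 ≤ 1 - (t : ℝ) := sub_nonneg.mpr t.2.2
        dsimp only
        split_ifs <;> simp <;> linarith
      · rw [Finset.sum_coe_sort ({x, y} : Finset V) (fun v =>
          (1 - (t : ℝ)) * (if v = x then 1 else 0) + t * (if v = y then 1 else 0)),
          Finset.sum_add_distrib, ← Finset.mul_sum, ← Finset.mul_sum]
        simp⟩
  continuous_toFun := by
    refine (continuous_cell _).comp (Continuous.subtype_mk (continuous_pi fun v => ?_) _)
    fun_prop
  source' := by
    apply Subtype.ext
    funext v
    by_cases hx : v = x <;> by_cases hy : v = y <;> simp [cell, vertex, hx, hy]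
  target' := by
    apply Subtype.ext
    funext v
    by_cases hx : v = x <;> by_cases hy : v = y <;> simp [cell, vertex, hx, hy]

open Classical in
/-- The edge path in the realization through the vertices `x 0, x 1, …, x n`. -/
def edgePath (K : AbstractSimplicialComplex V) : ∀ {n : ℕ} (x : Fin (n + 1) → V)
    (_ : ∀ i : Fin n, ({x i.castSucc, x i.succ} : Finset V) ∈ K.faces),
    Path (vertex K (x 0)) (vertex K (x (Fin.last n)))
  | 0, x, _ => Path.refl (vertex K (x 0))
  | _ + 1, x, h => (edgePath K (fun i => x i.castSucc) fun i => h i.castSucc).trans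
      (edge K (h (Fin.last _)))

open Classical in
/-- The edge loop in the realization through the vertices `x 0, x 1, …, x n, x 0`. -/
def edgeLoop (K : AbstractSimplicialComplex V) {n : ℕ} (x : Fin (n + 1) → V)
    (h : ∀ i : Fin n, ({x i.castSucc, x i.succ} : Finset V) ∈ K.faces)
    (h' : ({x (Fin.last n), x 0} : Finset V) ∈ K.faces) :
    Path (vertex K (x 0)) (vertex K (x 0)) :=
  (edgePath K x h).trans (edge K h')

end Realization

end Realization

/-! ### Open Rips complexes and samples of loops -/

section Rips

variable (X : Type u) [MetricSpace X]

/-- The open Rips complex: the faces are the nonempty finite sets of diameter `< r`. -/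
def rips (r : ℝ) (hr : 0 < r) : AbstractSimplicialComplex X where
  faces := {s | s.Nonempty ∧ Metric.diam (s : Set X) < r}
  isRelLowerSet_faces := fun _ hs => ⟨hs.1, fun _ hts ht =>
    ⟨ht, (Metric.diam_mono (Finset.coe_subset.mpr hts)
      (Finset.finite_toSet _).isBounded).trans_lt hs.2⟩⟩
  singleton_mem x := by simpa using hr

/-- The geometric realization of the open Rips complex. -/
abbrev Rips (r : ℝ) (hr : 0 < r) : Type u := Realization (rips X r hr)

theorem rips_mono {p q : ℝ} (hp : 0 < p) (hpq : p < q) :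
    rips X p hp ≤ rips X q (hp.trans hpq) :=
  fun _ hs => ⟨hs.1, hs.2.trans hpq⟩

/-- The bonding map `i_{p,q} : Rips(X, p) → Rips(X, q)`. -/
def bonding {p q : ℝ} (hp : 0 < p) (hpq : p < q) : C(Rips X p hp, Rips X q (hp.trans hpq)) :=
  Realization.incl (rips_mono X hp hpq)

variable {X}

open Classical in
theorem pair_mem_rips {r : ℝ} (hr : 0 < r) {S : Set X} (hS : Bornology.IsBounded S)
    (hd : Metric.diam S < r) {x y : X} (hx : x ∈ S) (hy : y ∈ S) :
    ({x, y} : Finset X) ∈ (rips X r hr).faces :=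
  ⟨Finset.insert_nonempty _ _, by
    simpa [Metric.diam_pair] using (Metric.dist_le_diam_of_mem hS hx hy).trans_lt hd⟩

/-- An `r`-sample of a loop `α`: parameters `t 0 < t 1 < ⋯ < t m` cutting the (cyclic) domain into
arcs whose images have diameter `< r`. -/
structure Sample {x : X} (α : Path x x) (r : ℝ) where
  m : ℕ
  t : Fin (m + 1) → unitInterval
  strictMono : StrictMono t
  diam_lt : ∀ i : Fin m, Metric.diam (α '' Set.Icc (t i.castSucc) (t i.succ)) < r
  diam_wrap_lt : Metric.diam (α '' (Set.Icc 0 (t 0) ∪ Set.Icc (t (Fin.last m)) 1)) < r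

/-- The loop in `Rips(X, r)` given by an `r`-sample, through the vertices
`α (t 0), α (t 1), …, α (t m), α (t 0)`. -/
def Sample.loop {x : X} {α : Path x x} {r : ℝ} (s : Sample α r) (hr : 0 < r) :
    Path (Realization.vertex (rips X r hr) (α (s.t 0)))
      (Realization.vertex (rips X r hr) (α (s.t 0))) :=
  Realization.edgeLoop (rips X r hr) (fun i => α (s.t i))
    (fun i => pair_mem_rips hr ((isCompact_Icc.image α.continuous).isBounded) (s.diam_lt i)
      ⟨_, Set.left_mem_Icc.mpr (s.strictMono.monotone i.castSucc_lt_succ.le), rfl⟩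
      ⟨_, Set.right_mem_Icc.mpr (s.strictMono.monotone i.castSucc_lt_succ.le), rfl⟩)
    (pair_mem_rips hr (((isCompact_Icc.union isCompact_Icc).image α.continuous).isBounded)
      s.diam_wrap_lt
      ⟨_, Or.inr (Set.left_mem_Icc.mpr unitInterval.le_one'), rfl⟩
      ⟨_, Or.inl (Set.right_mem_Icc.mpr unitInterval.nonneg'), rfl⟩)

/-- The based loop in `Rips(X, r)` given by an `r`-sample with `t 0 = 0`. -/
def Sample.basedLoop {x : X} {α : Path x x} {r : ℝ} (s : Sample α r) (hs : s.t 0 = 0)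
    (hr : 0 < r) :
    Path (Realization.vertex (rips X r hr) x) (Realization.vertex (rips X r hr) x) :=
  (s.loop hr).cast (by rw [hs, α.source]) (by rw [hs, α.source])

end Rips

/-! ### Fundamental groups -/

section FundamentalGroup

/-- The class of a loop in the fundamental group. -/
def loopClass {Y : Type u} [TopologicalSpace Y] {y : Y} (α : Path y y) : FundamentalGroup Y y :=
  FundamentalGroup.fromPath (Path.Homotopic.Quotient.mk α)

variable (X : Type u) [MetricSpace X] (x₀ : X)

/-- `S(X, r, π₁)`: the subgroup of `π₁(X, x₀)` generated by the lassos `α * β * α⁻`, where `α` is a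
path from `x₀` and `β` is a loop contained in a closed ball of radius `d < r`. -/
def spanierPi (r : ℝ) : Subgroup (FundamentalGroup X x₀) :=
  Subgroup.closure {c | ∃ (y w : X) (d : ℝ) (α : Path x₀ y) (β : Path y y), d < r ∧
    Set.range β ⊆ Metric.closedBall w d ∧ c = loopClass ((α.trans β).trans α.symm)}

instance spanierPi_normal (r : ℝ) : (spanierPi X x₀ r).Normal := by
  refine ⟨fun n hn g => ?_⟩
  refine Subgroup.closure_induction (p := fun n _ => g * n * g⁻¹ ∈ spanierPi X x₀ r)
    ?_ ?_ ?_ ?_ hn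
  · rintro c ⟨y, w, d, α, β, hd, hβ, rfl⟩
    obtain ⟨γ, rfl⟩ := Path.Homotopic.Quotient.mk_surjective g
    refine Subgroup.subset_closure ⟨y, w, d, γ.symm.trans α, β, hd, hβ, ?_⟩
    simp only [loopClass, FundamentalGroup.mul_def, FundamentalGroup.inv_def, Path.trans_symm,
      Path.symm_symm, Path.Homotopic.Quotient.mk_trans, Path.Homotopic.Quotient.mk_symm,
      Path.Homotopic.Quotient.trans_assoc]
  · rw [mul_one, mul_inv_cancel]
    exact Subgroup.one_mem _
  · intro a b _ _ ha hb
    have h := Subgroup.mul_mem _ ha hb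
    rwa [show g * a * g⁻¹ * (g * b * g⁻¹) = g * (a * b) * g⁻¹ by group] at h
  · intro a _ ha
    have h := Subgroup.inv_mem _ ha
    rwa [show (g * a * g⁻¹)⁻¹ = g * a⁻¹ * g⁻¹ by group] at h

theorem spanierPi_mono {p q : ℝ} (h : p ≤ q) : spanierPi X x₀ p ≤ spanierPi X x₀ q :=
  Subgroup.closure_mono fun _ ⟨y, w, d, α, β, hd, hβ⟩ => ⟨y, w, d, α, β, hd.trans_le h, hβ⟩

/-- The bonding map `π₁(X, x₀) / S(X, p, π₁) → π₁(X, x₀) / S(X, q, π₁)`. -/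
def spanierPiBonding {p q : ℝ} (h : p ≤ q) :
    FundamentalGroup X x₀ ⧸ spanierPi X x₀ p →* FundamentalGroup X x₀ ⧸ spanierPi X x₀ q :=
  QuotientGroup.map _ _ (MonoidHom.id _) (spanierPi_mono X x₀ h)

/-- The map `π₁(Rips(X, p), x₀) → π₁(Rips(X, q), x₀)` induced by the bonding map. -/
def ripsPiBonding {p q : ℝ} (hp : 0 < p) (hpq : p < q) :
    FundamentalGroup (Rips X p hp) (Realization.vertex _ x₀) →*
      FundamentalGroup (Rips X q (hp.trans hpq)) (Realization.vertex _ x₀) :=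
  FundamentalGroup.mapOfEq (bonding X hp hpq) (Realization.incl_vertex _ x₀)

end FundamentalGroup

/-! ### First homology groups -/

section Homology

/-- The singular chain complex of `Y` with coefficients in `G`. -/
abbrev singularChains (Y : Type u) [TopologicalSpace Y] (G : Type v) [AddCommGroup G] :
    ChainComplex AddCommGrpCat.{max u v} ℕ :=
  (TopCat.toSSet.obj (TopCat.of Y)).chainComplex (AddCommGrpCat.of (ULift.{u} G))

/-- The first singular homology group `H₁(Y; G)`. -/
abbrev H₁ (Y : Type u) [TopologicalSpace Y] (G : Type v) [AddCommGroup G] :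
    AddCommGrpCat.{max u v} :=
  ((AlgebraicTopology.singularHomologyFunctor AddCommGrpCat.{max u v} 1).obj
    (AddCommGrpCat.of (ULift.{u} G))).obj (TopCat.of Y)

/-- The homomorphism `H₁(Y; G) → H₁(Z; G)` induced by a continuous map. -/
def H₁map {Y Z : Type u} [TopologicalSpace Y] [TopologicalSpace Z] (f : C(Y, Z))
    (G : Type v) [AddCommGroup G] : H₁ Y G →+ H₁ Z G :=
  (((AlgebraicTopology.singularHomologyFunctor AddCommGrpCat.{max u v} 1).obj
    (AddCommGrpCat.of (ULift.{u} G))).map (TopCat.ofHom f)).hom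

section Cycle

variable {Y : Type u} [TopologicalSpace Y] {y : Y} (α : Path y y) (G : Type v) [AddCommGroup G]

/-- A loop as a singular `1`-simplex. -/
def loopSimplex : (TopCat.toSSet.obj (TopCat.of Y)).obj (Opposite.op (SimplexCategory.mk 1)) :=
  TopCat.toSSetObj₁Equiv.symm (TopCat.pathEquiv (X := TopCat.of Y).symm α).hom

/-- The homomorphism from `G` to the singular `1`-chains sending `g` to the chain `g • α`. -/
def loopChain : AddCommGrpCat.of (ULift.{u} G) ⟶ (singularChains Y G).X 1 :=
  SSet.ιChainComplex _ (loopSimplex α)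

theorem loopChain_d : loopChain α G ≫ (singularChains Y G).d 1 0 = 0 := by
  rw [loopChain, SSet.ιChainComplex_d]
  have h0 := (TopCat.pathEquiv (X := TopCat.of Y).symm α).hom₀
  have h1 := (TopCat.pathEquiv (X := TopCat.of Y).symm α).hom₁
  simp [Fin.sum_univ_two, loopSimplex, h0, h1]

/-- The homology class of the cycle `g • α`, as a homomorphism in `g`. -/
def loopHom : G →+ H₁ Y G :=
  ((singularChains Y G).liftCycles (loopChain α G) 0 (by simp) (loopChain_d α G) ≫
    (singularChains Y G).homologyπ 1).hom.comp AddEquiv.ulift.symm.toAddMonoidHom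

end Cycle

variable (X : Type u) [MetricSpace X] (G : Type v) [AddCommGroup G]

/-- `S(X, r, G)`: the subgroup of `H₁(X; G)` generated by the classes of the cycles `g • β`, where
`β` is a loop contained in a closed ball of radius `d < r`. -/
def spanierH (r : ℝ) : AddSubgroup (H₁ X G) :=
  AddSubgroup.closure {c | ∃ (y w : X) (d : ℝ) (β : Path y y) (g : G), d < r ∧
    Set.range β ⊆ Metric.closedBall w d ∧ c = loopHom β G g}

theorem spanierH_mono {p q : ℝ} (h : p ≤ q) : spanierH X G p ≤ spanierH X G q :=
  AddSubgroup.closure_mono fun _ ⟨y, w, d, β, g, hd, hβ⟩ => ⟨y, w, d, β, g, hd.trans_le h, hβ⟩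

/-- The bonding map `H₁(X; G) / S(X, p, G) → H₁(X; G) / S(X, q, G)`. -/
def spanierHBonding {p q : ℝ} (h : p ≤ q) :
    H₁ X G ⧸ spanierH X G p →+ H₁ X G ⧸ spanierH X G q :=
  QuotientAddGroup.map _ _ (AddMonoidHom.id _) (spanierH_mono X G h)

/-- The map `H₁(Rips(X, p); G) → H₁(Rips(X, q); G)` induced by the bonding map. -/
def ripsHBonding {p q : ℝ} (hp : 0 < p) (hpq : p < q) :
    H₁ (Rips X p hp) G →+ H₁ (Rips X q (hp.trans hpq)) G :=
  H₁map (bonding X hp hpq) G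

end Homology

end RipsSpanier

end

/-! The proof compares homotopy invariant, multiplicative functions on all paths of a space, that
is, functors from the fundamental groupoid to a group (`PathHom`). Unlike homomorphisms on loops,
these are local. They are determined by their values on small paths (`path_induction`). Conversely,
a two-point function satisfying the cocycle identity on each member of an open cover extends to all
paths, as the monodromy of the covering space that it glues together
(`IsLocalCocycle.exists_pathHom`).

From $X$ to the Rips complex, a path of diameter $<r$ goes to the edge joining its endpoints; the
cocycle identity holds because three points at mutual distance $<r$ span a simplex. A loop in a
closed ball of centre $w$ and radius $d<3r/2$ is killed (`IsSampleHom.eq_one`): it is coned off to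
$w$ through the points at two thirds of the geodesics from $w$, and every edge used is shorter than
$r$.

Back from the Rips complex, an edge goes to a geodesic, modulo the Spanier group. A geodesic
triangle with sides $<r$ has perimeter $<3r$, so it lies in a ball of radius $<3r/2$ about a vertex
and is killed (`VanishesOnBalls.geodesic_mul`). Both directions thus meet at the threshold $3r/2$.
The two composites agree with the evident homomorphisms on small pieces up to a coboundary, hence
everywhere, and the coboundary is trivial at the base point (`exists_piEquiv`).

For homology, a path homomorphism into $\mathrm{Hom}(G,A)$ extends to $H_1(-;G)\to A$
(`exists_homologyDesc`), and homomorphisms out of $H_1$ are determined on based loops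
(`homology_hom_ext`). The second isomorphism therefore follows from the first. Compatibility with
bonding maps holds because a sample at scale $p$ is also one at scale $q>p$. -/

noncomputable section
namespace RipsSpanier

/-! ### Homomorphisms from paths to a group -/

section PathHom

variable {Y : Type*} [TopologicalSpace Y]

open unitInterval

/-- A property of paths that is invariant under homotopy and closed under concatenation holds for a
path if it holds for all of its subpaths which are contained in a member of an open cover. -/
theorem path_induction {P : ∀ {p q : Y}, Path p q → Prop}
    (hP : ∀ {p q : Y} {γ δ : Path p q}, γ.Homotopic δ → P γ → P δ)
    (htrans : ∀ {p q s : Y} (γ : Path p q) (δ : Path q s), P γ → P δ → P (γ.trans δ))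
    {x y : Y} (γ : Path x y) (𝒰 : Set (Set Y)) (hU : ∀ U ∈ 𝒰, IsOpen U)
    (hcov : ∀ t, ∃ U ∈ 𝒰, γ t ∈ U)
    (hsmall : ∀ s t : I, s ≤ t → ∀ U ∈ 𝒰, Set.range (γ.subpath s t) ⊆ U → P (γ.subpath s t)) :
    P γ := by
  obtain ⟨t, h0, hmono, ⟨n, hn⟩, ht⟩ := exists_monotone_Icc_subset_open_cover_unitInterval
    (c := fun U : 𝒰 => γ ⁻¹' U.1) (fun U => (hU _ U.2).preimage γ.continuous)
    (fun s _ => by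
      obtain ⟨U, hU, hs⟩ := hcov s
      exact Set.mem_iUnion.mpr ⟨⟨U, hU⟩, hs⟩)
  have hstep : ∀ k, P (γ.subpath (t k) (t (k + 1))) := fun k => by
    obtain ⟨U, hk⟩ := ht k
    refine hsmall _ _ (hmono k.le_succ) _ U.2 ?_
    rw [Path.range_subpath_of_le _ _ _ (hmono k.le_succ), Set.image_subset_iff]
    exact hk
  have hall : ∀ k, P (γ.subpath (t 0) (t (k + 1))) := fun k => by
    induction k with
    | zero => exact hstep 0
    | succ k ih =>
      exact hP ⟨Path.Homotopy.subpathTransSubpath γ _ _ _⟩ (htrans _ _ ih (hstep (k + 1)))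
  have h1 := hall n
  rw [h0, hn (n + 1) n.le_succ, Path.subpath_zero_one] at h1
  have hcast : ∀ {x' y' : Y} (hx : x' = x) (hy : y' = y), P (γ.cast hx hy) → P γ := by
    rintro _ _ rfl rfl h
    exact h
  exact hcast _ _ h1

variable (Y) in
/-- A homotopy invariant assignment of elements of a group to paths which is multiplicative (with
the order of factors of `FundamentalGroup`). -/
structure PathHom (Q : Type*) [Group Q] where
  toFun : ∀ {p q : Y}, Path p q → Q
  map_homotopic : ∀ {p q : Y} {γ δ : Path p q}, γ.Homotopic δ → toFun γ = toFun δ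
  map_trans : ∀ {p q s : Y} (γ : Path p q) (δ : Path q s),
    toFun (γ.trans δ) = toFun δ * toFun γ

namespace PathHom

variable {Q : Type*} [Group Q] (F : PathHom Y Q)

instance : CoeFun (PathHom Y Q) fun _ => ∀ {p q : Y}, Path p q → Q := ⟨@PathHom.toFun Y _ Q _⟩

@[simp] theorem trans_apply {p q s : Y} (γ : Path p q) (δ : Path q s) :
    F (γ.trans δ) = F δ * F γ := F.map_trans γ δ

@[simp] theorem refl_apply (p : Y) : F (Path.refl p) = 1 := by
  have h := F.map_trans (Path.refl p) (Path.refl p)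
  rw [Path.refl_trans_refl] at h
  exact left_eq_mul.mp h

@[simp] theorem symm_apply {p q : Y} (γ : Path p q) : F γ.symm = (F γ)⁻¹ := by
  have h : F (γ.trans γ.symm) = F (Path.refl p) := F.map_homotopic (Path.Homotopic.trans_symm γ)
  rw [trans_apply, refl_apply] at h
  exact eq_inv_of_mul_eq_one_left h

theorem cast_apply {p q p' q' : Y} (hp : p' = p) (hq : q' = q) (γ : Path p q) :
    F (γ.cast hp hq) = F γ := by
  subst hp hq; rfl

theorem subpath_mul_subpath {p q : Y} (γ : Path p q) (a b c : I) :
    F (γ.subpath b c) * F (γ.subpath a b) = F (γ.subpath a c) := by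
  rw [← trans_apply]
  exact F.map_homotopic ⟨Path.Homotopy.subpathTransSubpath γ _ _ _⟩

theorem subpath_zero_one {p q : Y} (γ : Path p q) : F (γ.subpath 0 1) = F γ := by
  rw [Path.subpath_zero_one, cast_apply]

/-- Restriction to the fundamental group. -/
def toMonoidHom (y : Y) : FundamentalGroup Y y →* Q where
  toFun c := Quotient.lift (s := Path.Homotopic.setoid y y) (fun γ : Path y y => F γ)
    (fun _ _ h => F.map_homotopic h) c
  map_one' := F.refl_apply y
  map_mul' a b := by
    obtain ⟨a, rfl⟩ := Path.Homotopic.Quotient.mk_surjective a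
    obtain ⟨b, rfl⟩ := Path.Homotopic.Quotient.mk_surjective b
    exact F.map_trans b a

/-- Push a path homomorphism forward along a homomorphism of groups. -/
def comp {R : Type*} [Group R] (f : Q →* R) : PathHom Y R where
  toFun γ := f (F γ)
  map_homotopic h := by rw [F.map_homotopic h]
  map_trans γ δ := by rw [F.map_trans, map_mul]

/-- The value of a path homomorphism only depends on the underlying function of a path. -/
theorem congr {p q p' q' : Y} (γ : Path p q) (δ : Path p' q') (h : ∀ t, γ t = δ t) : F γ = F δ := by
  obtain rfl : p = p' := by simpa using h 0
  obtain rfl : q = q' := by simpa using h 1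
  rw [Path.ext (funext h)]

/-- Precomposition of a path homomorphism with a continuous map. -/
def comap {Z : Type*} [TopologicalSpace Z] (f : C(Z, Y)) : PathHom Z Q where
  toFun γ := F (γ.map f.continuous)
  map_homotopic h := F.map_homotopic (h.map f)
  map_trans γ δ := by rw [Path.map_trans, F.map_trans]

theorem comap_apply {Z : Type*} [TopologicalSpace Z] (f : C(Z, Y)) {p q : Z} (γ : Path p q) :
    F.comap f γ = F (γ.map f.continuous) := rfl

theorem eq_of_simplyConnected [SimplyConnectedSpace Y] {p q : Y} (γ δ : Path p q) : F γ = F δ :=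
  F.map_homotopic (SimplyConnectedSpace.paths_homotopic γ δ)

/-- The values of a path homomorphism on the sides of a square. -/
theorem square (H : C(I × I, Y)) {p q p' q' : Y} (γ : Path p q) (α : Path p p') (β : Path q q')
    (δ : Path p' q') (hγ : ∀ t, H (t, 0) = γ t) (hα : ∀ t, H (0, t) = α t)
    (hβ : ∀ t, H (1, t) = β t) (hδ : ∀ t, H (t, 1) = δ t) : F β * F γ = F δ * F α := by
  have : ContractibleSpace I := (convex_Icc (0 : ℝ) 1).contractibleSpace ⟨0, unitInterval.zero_mem⟩
  let ι : Path (0 : I) 1 := ⟨ContinuousMap.id I, rfl, rfl⟩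
  have h := (F.comap H).eq_of_simplyConnected
    ((ι.prod (Path.refl 0)).trans ((Path.refl 1).prod ι))
    (((Path.refl 0).prod ι).trans (ι.prod (Path.refl 1)))
  rw [trans_apply, trans_apply] at h
  simp only [comap_apply] at h
  exact (congrArg₂ _ (F.congr _ _ hβ) (F.congr _ _ hγ)).symm.trans
    (h.trans (congrArg₂ _ (F.congr _ _ hδ) (F.congr _ _ hα)))

/-- Two path homomorphisms that agree up to a coboundary on the small subpaths of `γ` agree up to
this coboundary on `γ`. -/
theorem eq_of_locally_eq (F' : PathHom Y Q) (b : Y → Q) {x y : Y} (γ : Path x y)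
    (𝒰 : Set (Set Y)) (hU : ∀ U ∈ 𝒰, IsOpen U) (hcov : ∀ t, ∃ U ∈ 𝒰, γ t ∈ U)
    (h : ∀ s t : I, s ≤ t → ∀ U ∈ 𝒰, Set.range (γ.subpath s t) ⊆ U →
      F (γ.subpath s t) = b (γ t) * F' (γ.subpath s t) * (b (γ s))⁻¹) :
    F γ = b y * F' γ * (b x)⁻¹ := by
  refine path_induction (P := fun {p q} δ => F δ = b q * F' δ * (b p)⁻¹) ?_ ?_ γ 𝒰 hU hcov h
  · intro p q γ δ hγ h
    rw [← F.map_homotopic hγ, ← F'.map_homotopic hγ, h]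
  · intro p q s γ δ hγ hδ
    rw [trans_apply, trans_apply, hγ, hδ]
    group

/-- The trivial path homomorphism. -/
instance : One (PathHom Y Q) := ⟨⟨fun _ => 1, fun _ => rfl, fun _ _ => (one_mul 1).symm⟩⟩

end PathHom

/-! ### Gluing a path homomorphism from local data -/

section Cocycle

variable {Q : Type*} [Group Q] (𝒰 : Set (Set Y)) (c : Y → Y → Q)

/-- A group-valued function of two points is a local cocycle with respect to a cover by open sets
if it satisfies the cocycle identity on every member of the cover. -/
structure IsLocalCocycle : Prop where
  isOpen : ∀ U ∈ 𝒰, IsOpen U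
  exists_mem : ∀ p : Y, ∃ U ∈ 𝒰, p ∈ U
  mul_eq : ∀ U ∈ 𝒰, ∀ p ∈ U, ∀ q ∈ U, ∀ s ∈ U, c q s * c p q = c p s

variable {𝒰 c}

namespace IsLocalCocycle

variable (h : IsLocalCocycle 𝒰 c)
include h

theorem self_eq_one (p : Y) : c p p = 1 := by
  obtain ⟨U, hU, hp⟩ := h.exists_mem p
  exact left_eq_mul.mp (h.mul_eq U hU p hp p hp p hp).symm

/-- The principal bundle with discrete fiber `Q` defined by a local cocycle. -/
def bundleCore [TopologicalSpace Q] [DiscreteTopology Q] :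
    FiberBundleCore {i : Set Y × Y // i.1 ∈ 𝒰 ∧ i.2 ∈ i.1} Y Q where
  baseSet i := i.1.1
  isOpen_baseSet i := h.isOpen _ i.2.1
  indexAt p := ⟨((h.exists_mem p).choose, p), (h.exists_mem p).choose_spec⟩
  mem_baseSet_at p := (h.exists_mem p).choose_spec.2
  -- A chart is a pointed member of the cover, and its coordinate at `x` is normalised by transport
  -- from `x` to the marked point. Transitions are left multiplications, so right multiplication by
  -- `Q` acts on the bundle.
  coordChange i j x v := c x j.1.2 * (c x i.1.2)⁻¹ * v
  coordChange_self i x _ v := by simp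
  continuousOn_coordChange i j := by
    rintro ⟨x, v⟩ ⟨⟨hxi, hxj⟩, -⟩
    refine (ContinuousOn.congr (f := fun p : Y × Q => c x j.1.2 * (c x i.1.2)⁻¹ * p.2) ?_ ?_)
      (x, v) ⟨⟨hxi, hxj⟩, trivial⟩
    · exact (continuous_of_discreteTopology (f := fun q => c x j.1.2 * (c x i.1.2)⁻¹ * q)).comp
        continuous_snd |>.continuousOn
    · rintro ⟨y, w⟩ ⟨⟨hyi, hyj⟩, -⟩
      -- Both factors pick up the same `c y x`, which cancels: the transition function is constant
      -- on the overlap.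
      have hi := h.mul_eq _ i.2.1 y hyi x hxi _ i.2.2
      have hj := h.mul_eq _ j.2.1 y hyj x hxj _ j.2.2
      simp only [← hi, ← hj]
      group
  coordChange_comp i j k x _ v := by group

theorem exists_pathHom : ∃ F : PathHom Y Q, ∀ U ∈ 𝒰, ∀ {p q : Y} (γ : Path p q),
    Set.range γ ⊆ U → F γ = c p q := by
  let _ : TopologicalSpace Q := ⊥
  have : DiscreteTopology Q := ⟨rfl⟩
  let Z := h.bundleCore
  have cov : IsCoveringMap (Bundle.TotalSpace.proj : Bundle.TotalSpace Q Z.Fiber → Y) :=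
    FiberBundle.isCoveringMap (F := Q) (E := Z.Fiber)
  let L : ∀ {p q : Y}, Path p q → Q → Q := fun {p q} γ a =>
    (cov.monodromy (.mk γ) ⟨(⟨p, a⟩ : Bundle.TotalSpace Q Z.Fiber), rfl⟩).1.2
  have hL : ∀ {p q : Y} (γ : Path p q) (a : Q),
      cov.monodromy (.mk γ) ⟨(⟨p, a⟩ : Bundle.TotalSpace Q Z.Fiber), rfl⟩ =
        ⟨(⟨q, L γ a⟩ : Bundle.TotalSpace Q Z.Fiber), rfl⟩ := fun {p q} γ a =>
    Subtype.ext (Bundle.TotalSpace.ext (cov.monodromy (.mk γ) _).2 HEq.rfl)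
  have hhom : ∀ {p q : Y} {γ δ : Path p q} (a : Q), γ.Homotopic δ → L γ a = L δ a := by
    intro p q γ δ a hγ
    exact congrArg (fun c => ((cov.monodromy c
      ⟨(⟨p, a⟩ : Bundle.TotalSpace Q Z.Fiber), rfl⟩).1.2 : Q)) (Path.Homotopic.Quotient.eq.mpr hγ)
  have htrans : ∀ {p q s : Y} (γ : Path p q) (δ : Path q s) (a : Q),
      L (γ.trans δ) a = L δ (L γ a) := by
    intro p q s γ δ a
    have h1 := cov.monodromy_trans_apply (.mk γ) (.mk δ)
      ⟨(⟨p, a⟩ : Bundle.TotalSpace Q Z.Fiber), rfl⟩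
    rw [hL γ a, hL δ (L γ a)] at h1
    exact congrArg (fun e => (e.1.2 : Q)) h1
  have hsmall : ∀ U ∈ 𝒰, ∀ {p q : Y} (γ : Path p q) (a : Q), Set.range γ ⊆ U →
      L γ a = c p q * a := by
    intro U hU p q γ a hγ
    have hp : p ∈ U := hγ ⟨0, γ.source⟩
    let i : {i : Set Y × Y // i.1 ∈ 𝒰 ∧ i.2 ∈ i.1} := ⟨(U, p), hU, hp⟩
    -- The lift with constant coordinate `a` in the chart `(U, p)`, rewritten in the preferred chart
    -- at `γ t`.
    let Γ : I → Bundle.TotalSpace Q Z.Fiber := fun t => ⟨γ t, (c (γ t) p)⁻¹ * a⟩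
    have hΓ' : Γ = fun t => (Z.localTriv i).toOpenPartialHomeomorph.symm (γ t, a) := by
      funext t
      refine Bundle.TotalSpace.ext rfl (heq_of_eq ?_)
      change _ = c (γ t) (γ t) * (c (γ t) p)⁻¹ * a
      rw [h.self_eq_one, one_mul]
    have hcont : Continuous Γ := by
      rw [hΓ']
      refine (Z.localTriv i).toOpenPartialHomeomorph.continuousOn_symm.comp_continuous
        (by fun_prop) fun t => ?_
      rw [Bundle.Trivialization.mem_target]
      exact hγ ⟨t, rfl⟩
    have hΓ : Γ = cov.liftPath γ (⟨p, a⟩ : Bundle.TotalSpace Q Z.Fiber) γ.source := by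
      rw [cov.eq_liftPath_iff]
      refine ⟨hcont, rfl, Bundle.TotalSpace.ext γ.source (heq_of_eq ?_)⟩
      change (c (γ 0) p)⁻¹ * a = a
      rw [γ.source, h.self_eq_one, inv_one, one_mul]
    have h1 : L γ a = (c (γ 1) p)⁻¹ * a :=
      (congrArg (fun e : Bundle.TotalSpace Q Z.Fiber => (e.2 : Q)) (congrFun hΓ 1)).symm
    have hq : q ∈ U := hγ ⟨1, γ.target⟩
    have h2 := h.mul_eq U hU p hp q hq p hp
    rw [h.self_eq_one] at h2
    rw [h1, γ.target, inv_eq_of_mul_eq_one_right h2]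
  have hequiv : ∀ {p q : Y} (γ : Path p q) (a : Q), L γ a = L γ 1 * a := by
    intro p q γ
    refine path_induction (P := fun {p q} γ => ∀ a, L γ a = L γ 1 * a) ?_ ?_ γ 𝒰 h.isOpen
      (fun t => h.exists_mem _) ?_
    · intro p q γ δ hγ h a
      rw [← hhom _ hγ, ← hhom _ hγ, h]
    · intro p q s γ δ hγ hδ a
      rw [htrans, htrans, hδ, hγ, hδ (L γ 1), mul_assoc]
    · intro s t _ U hU hs a
      rw [hsmall U hU _ _ hs, hsmall U hU _ _ hs, mul_one]
  refine ⟨⟨fun γ => L γ 1, fun hγ => hhom 1 hγ, fun γ δ => ?_⟩, fun U hU p q γ hγ => ?_⟩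
  · rw [htrans, hequiv]
  · exact (hsmall U hU γ 1 hγ).trans (mul_one _)

end IsLocalCocycle

end Cocycle

/-! ### Transport to a base point -/

section BasePaths

/-- The path homomorphism to the fundamental group determined by a choice of base paths. -/
def PathHom.ofBasePaths {y₀ : Y} (C : ∀ p, Path y₀ p) : PathHom Y (FundamentalGroup Y y₀) where
  toFun {p q} γ := FundamentalGroup.fromPath
    (.mk (((C p).trans γ).trans (C q).symm))
  map_homotopic h := Path.Homotopic.Quotient.eq.mpr
    (((Path.Homotopic.refl _).hcomp h).hcomp (Path.Homotopic.refl _))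
  map_trans γ δ := by
    simp only [FundamentalGroup.mul_def, Path.Homotopic.Quotient.mk_trans,
      Path.Homotopic.Quotient.mk_symm]
    grind

theorem PathHom.ofBasePaths_loop {y₀ : Y} (C : ∀ p, Path y₀ p) (hC : C y₀ = Path.refl y₀)
    (γ : Path y₀ y₀) :
    PathHom.ofBasePaths C γ = FundamentalGroup.fromPath (.mk γ) := by
  simp [PathHom.ofBasePaths, hC, -Path.Homotopic.Quotient.mk_symm]

theorem exists_basePaths [PathConnectedSpace Y] (y₀ : Y) :
    ∃ C : ∀ p, Path y₀ p, C y₀ = Path.refl y₀ := by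
  classical
  exact ⟨fun p => if h : p = y₀ then (Path.refl y₀).cast rfl h else
    PathConnectedSpace.somePath y₀ p, dif_pos rfl⟩

end BasePaths

end PathHom

end RipsSpanier
end

noncomputable section
namespace RipsSpanier

/-! ### Paths in the realization of a simplicial complex -/

namespace Realization

open unitInterval

variable {V : Type u} {K : AbstractSimplicialComplex V}

theorem mem_faces_of_ne_zero (p : Realization K) {t : Finset V} (ht : t.Nonempty)
    (h : ∀ v ∈ t, p.1 v ≠ 0) : t ∈ K.faces := by
  obtain ⟨s, hs, hp, -⟩ := p.2.2
  exact (K.isRelLowerSet_faces hs).2 (fun v hv => not_imp_comm.mp (hp v) (h v hv)) ht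

theorem exists_ne_zero (p : Realization K) : ∃ v, p.1 v ≠ 0 := by
  obtain ⟨s, -, -, hp⟩ := p.2.2
  obtain ⟨v, -, hv⟩ := Finset.exists_ne_zero_of_sum_ne_zero (hp.trans_ne one_ne_zero)
  exact ⟨v, hv⟩

theorem sum_eq_one (p : Realization K) {s : Finset V} (h : ∀ v ∉ s, p.1 v = 0) :
    ∑ v ∈ s, p.1 v = 1 := by
  classical
  obtain ⟨s', -, hp', h1⟩ := p.2.2
  exact ((Finset.sum_subset (Finset.subset_union_left (s₂ := s')) fun v _ hv => h v hv).trans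
    (Finset.sum_subset (Finset.subset_union_right (s₁ := s)) fun v _ hv => hp' v hv).symm).trans h1

/-- A face spans a closed simplex which contains both points. -/
def Carries (K : AbstractSimplicialComplex V) (s : Finset V) (p q : Realization K) : Prop :=
  s ∈ K.faces ∧ (∀ v ∉ s, p.1 v = 0) ∧ ∀ v ∉ s, q.1 v = 0

/-- The barycentric coordinates with respect to a face of a point of the face. -/
def coords {s : Finset V} (p : Realization K) (h : ∀ v ∉ s, p.1 v = 0) : stdSimplex ℝ s :=
  ⟨fun v => p.1 v, fun v => p.2.1 v, (Finset.sum_coe_sort s p.1).trans (sum_eq_one p h)⟩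

theorem cell_coords {s : Finset V} (hs : s ∈ K.faces) (p : Realization K)
    (h : ∀ v ∉ s, p.1 v = 0) : cell ⟨s, hs⟩ (coords p h) = p := by
  classical
  refine Subtype.ext (funext fun v => ?_)
  by_cases hv : v ∈ s
  · exact dif_pos hv
  · exact (dif_neg hv).trans (h v hv).symm

/-- The segment between two points of a simplex. -/
def segment {ι : Type*} [Fintype ι] (x : stdSimplex ℝ ι × stdSimplex ℝ ι × I) : stdSimplex ℝ ι :=
  ⟨fun i => (1 - (x.2.2 : ℝ)) * x.1.1 i + x.2.2 * x.2.1.1 i,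
    convex_stdSimplex ℝ ι x.1.2 x.2.1.2 (sub_nonneg.mpr x.2.2.2.2) x.2.2.2.1 (by ring)⟩

theorem continuous_segment {ι : Type*} [Fintype ι] : Continuous (segment (ι := ι)) := by
  refine Continuous.subtype_mk (continuous_pi fun i => ?_) _
  have h1 : Continuous fun x : stdSimplex ℝ ι × stdSimplex ℝ ι × I => x.1.1 i :=
    (continuous_apply i).comp (continuous_subtype_val.comp continuous_fst)
  have h2 : Continuous fun x : stdSimplex ℝ ι × stdSimplex ℝ ι × I => x.2.1.1 i :=
    (continuous_apply i).comp (continuous_subtype_val.comp (continuous_fst.comp continuous_snd))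
  fun_prop

/-- The segment between two points of a simplex as a path. -/
def segmentPath {ι : Type*} [Fintype ι] (a b : stdSimplex ℝ ι) : Path a b where
  toFun t := segment (a, b, t)
  continuous_toFun := continuous_segment.comp (by fun_prop)
  source' := Subtype.ext (by simp [segment])
  target' := Subtype.ext (by simp [segment])

/-- The straight path between two points of the realization in a common closed simplex. -/
def line {p q : Realization K} (h : ∃ s, Carries K s p q) : Path p q :=
  ((segmentPath (coords p h.choose_spec.2.1) (coords q h.choose_spec.2.2)).map
    (continuous_cell ⟨h.choose, h.choose_spec.1⟩)).cast
    (cell_coords _ _ _).symm (cell_coords _ _ _).symm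

theorem cell_segment {s : Finset V} (hs : s ∈ K.faces) (a b : stdSimplex ℝ s) (t : I) (v : V) :
    (cell ⟨s, hs⟩ (segment (a, b, t))).1 v =
      (1 - (t : ℝ)) * (cell ⟨s, hs⟩ a).1 v + t * (cell ⟨s, hs⟩ b).1 v := by
  classical
  by_cases hv : v ∈ s <;> simp [cell, segment, hv]

theorem line_apply {p q : Realization K} (h : ∃ s, Carries K s p q) (t : I) (v : V) :
    (line h t).1 v = (1 - (t : ℝ)) * p.1 v + t * q.1 v := by
  refine (cell_segment h.choose_spec.1 _ _ t v).trans ?_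
  rw [cell_coords, cell_coords]

theorem vertex_apply_ne {x v : V} (h : v ≠ x) : (vertex K x).1 v = 0 := if_neg h

theorem vertex_apply_self (x : V) : (vertex K x).1 x = 1 := if_pos rfl

open Classical in
theorem edge_apply {x y : V} (h : ∃ s, Carries K s (vertex K x) (vertex K y))
    (h' : ({x, y} : Finset V) ∈ K.faces) (t : I) : edge K h' t = line h t := by
  refine Subtype.ext (funext fun v => ?_)
  rw [line_apply]
  have h1 : (edge K h' t).1 v = if v ∈ ({x, y} : Finset V) then
    (1 - (t : ℝ)) * (if v = x then 1 else 0) + t * (if v = y then 1 else 0) else 0 := rfl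
  rw [h1]
  by_cases hx : v = x <;> by_cases hy : v = y <;> simp [vertex, hx, hy]

section PathHom

variable {Q : Type*} [Group Q] (F : PathHom (Realization K) Q)

/-- A closed simplex is contractible, so inside it only the endpoints of a path matter. In
particular the face chosen by `line` is irrelevant. -/
theorem line_eq_comap {s : Finset V} (hs : s ∈ K.faces) {p q : Realization K}
    (hp : ∀ v ∉ s, p.1 v = 0) (hq : ∀ v ∉ s, q.1 v = 0) (δ : Path (coords p hp) (coords q hq)) :
    F (line ⟨s, hs, hp, hq⟩) = F.comap ⟨cell ⟨s, hs⟩, continuous_cell _⟩ δ := by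
  have : ContractibleSpace (stdSimplex ℝ s) :=
    (convex_stdSimplex ℝ s).contractibleSpace ⟨_, (coords p hp).2⟩
  rw [(F.comap _).eq_of_simplyConnected δ (segmentPath _ _), PathHom.comap_apply]
  refine F.congr _ _ fun t => Subtype.ext (funext fun v => ?_)
  rw [line_apply]
  refine Eq.trans ?_ (cell_segment hs _ _ t v).symm
  rw [cell_coords, cell_coords]

theorem line_mul_line {s : Finset V} {p q w : Realization K} (hpq : Carries K s p q)
    (hqw : Carries K s q w) :
    F (line ⟨s, hqw⟩) * F (line ⟨s, hpq⟩) = F (line ⟨s, hpq.1, hpq.2.1, hqw.2.2⟩) := by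
  rw [line_eq_comap F hpq.1 hpq.2.1 hpq.2.2 (segmentPath _ _),
    line_eq_comap F hpq.1 hpq.2.2 hqw.2.2 (segmentPath _ _),
    line_eq_comap F hpq.1 hpq.2.1 hqw.2.2 ((segmentPath _ _).trans (segmentPath _ _)),
    PathHom.trans_apply]

end PathHom

/-! ### Open stars and paths inside them -/

/-- The open star of a vertex. -/
def openStar (K : AbstractSimplicialComplex V) (u : V) : Set (Realization K) := {p | p.1 u ≠ 0}

theorem isOpen_iff {W : Set (Realization K)} :
    IsOpen W ↔ ∀ s : K.faces, IsOpen (cell s ⁻¹' W) := by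
  rw [isOpen_iSup_iff]
  exact forall_congr' fun s => isOpen_coinduced

theorem isOpen_openStar (u : V) : IsOpen (openStar K u) := by
  classical
  refine isOpen_iff.mpr fun s => ?_
  by_cases hu : u ∈ s.1
  · have h : cell s ⁻¹' openStar K u = {w | w.1 ⟨u, hu⟩ ≠ 0} := by
      ext w
      simp [openStar, cell, hu]
    rw [h]
    exact isOpen_ne_fun ((continuous_apply _).comp continuous_subtype_val) continuous_const
  · have h : cell s ⁻¹' openStar K u = ∅ := by
      ext w
      simp [openStar, cell, hu]
    rw [h]
    exact isOpen_empty

theorem carries_vertex {u : V} {p : Realization K} (hp : p ∈ openStar K u) :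
    ∃ s, Carries K s p (vertex K u) := by
  obtain ⟨s, hs, hps, -⟩ := p.2.2
  exact ⟨s, hs, hps, fun v hv => vertex_apply_ne fun h => hp (hps u (h ▸ hv))⟩

/-- The straight path from a point of an open star to the center, as a continuous function of the
point. -/
theorem continuous_line_vertex (u : V) :
    Continuous fun p : openStar K u => (line (carries_vertex p.2)).toContinuousMap := by
  classical
  -- Taking values in a path space avoids the product of the weak topology with the interval:
  -- openness can be tested on each closed simplex, where the map is the currying of an explicit
  -- continuous one.
  refine continuous_def.mpr fun W hW => ?_
  rw [(isOpen_openStar u).isOpenEmbedding_subtypeVal.isOpen_iff_image_isOpen, isOpen_iff]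
  intro s
  by_cases hu : u ∈ s.1
  · let e : stdSimplex ℝ (s : Finset V) :=
      coords (vertex K u) fun v hv => vertex_apply_ne fun h => hv (h ▸ hu)
    let G : C(stdSimplex ℝ (s : Finset V) × I, Realization K) :=
      ⟨fun x => cell s (segment (x.1, e, x.2)),
        (continuous_cell s).comp (continuous_segment.comp (by fun_prop))⟩
    have hG : ∀ (w : stdSimplex ℝ (s : Finset V)) (hw : cell s w ∈ openStar K u),
        G.curry w = (line (carries_vertex hw)).toContinuousMap := by
      intro w hw
      refine ContinuousMap.ext fun t => Subtype.ext (funext fun v => ?_)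
      refine (cell_segment s.2 w e t v).trans (Eq.trans ?_ (line_apply _ t v).symm)
      rw [cell_coords]
    have h : cell s ⁻¹' (Subtype.val '' ((fun p : openStar K u =>
        (line (carries_vertex p.2)).toContinuousMap) ⁻¹' W)) =
        cell s ⁻¹' openStar K u ∩ G.curry ⁻¹' W := by
      ext w
      constructor
      · rintro ⟨⟨p, hp⟩, hpW, hpw⟩
        obtain rfl : p = cell s w := hpw
        exact ⟨hp, by rw [Set.mem_preimage, hG w hp]; exact hpW⟩
      · rintro ⟨hw, hwW⟩
        rw [Set.mem_preimage, hG w hw] at hwW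
        exact ⟨⟨_, hw⟩, hwW, rfl⟩
    rw [h]
    exact ((isOpen_openStar u).preimage (continuous_cell s)).inter (hW.preimage G.curry.continuous)
  · convert isOpen_empty
    refine Set.eq_empty_of_forall_notMem ?_
    rintro w ⟨⟨p, hp⟩, -, hpw⟩
    obtain rfl : p = cell s w := hpw
    exact hp (dif_neg hu)

/-- The straight-line homotopy to the centre `u` is a square whose far side is constant; the other
three sides give the formula. -/
theorem apply_of_range_subset_openStar {Q : Type*} [Group Q] (F : PathHom (Realization K) Q)
    {u : V} {p q : Realization K} (γ : Path p q) (hγ : Set.range γ ⊆ openStar K u)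
    (hp : p ∈ openStar K u) (hq : q ∈ openStar K u) :
    F γ = (F (line (carries_vertex hq)))⁻¹ * F (line (carries_vertex hp)) := by
  let Γ : C(I, openStar K u) := ⟨fun t => ⟨γ t, hγ ⟨t, rfl⟩⟩, by fun_prop⟩
  let H : C(I × I, Realization K) :=
    (ContinuousMap.comp ⟨_, continuous_line_vertex u⟩ Γ).uncurry
  have hH : ∀ s t v, (H (s, t)).1 v = (1 - (t : ℝ)) * (γ s).1 v + t * (vertex K u).1 v :=
    fun s t v => line_apply (carries_vertex (hγ ⟨s, rfl⟩)) t v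
  have h := F.square H γ (line (carries_vertex hp)) (line (carries_vertex hq)) (Path.refl _)
    (fun t => Subtype.ext (funext fun v => by rw [hH]; simp))
    (fun t => Subtype.ext (funext fun v => by rw [hH, line_apply, γ.source]))
    (fun t => Subtype.ext (funext fun v => by rw [hH, line_apply, γ.target]))
    (fun t => Subtype.ext (funext fun v => by rw [hH]; simp))
  rw [PathHom.refl_apply, one_mul] at h
  rw [← h, inv_mul_cancel_left]

theorem joined_of_joined_vertices (h : ∀ x y, Joined (vertex K x) (vertex K y))
    [Nonempty V] : PathConnectedSpace (Realization K) := by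
  have h1 : ∀ p : Realization K, ∃ x, Joined p (vertex K x) := fun p => by
    obtain ⟨v, hv⟩ := p.exists_ne_zero
    exact ⟨v, ⟨line (carries_vertex hv)⟩⟩
  refine ⟨⟨vertex K (Classical.arbitrary V)⟩, fun p q => ?_⟩
  obtain ⟨x, hx⟩ := h1 p
  obtain ⟨y, hy⟩ := h1 q
  exact (hx.trans (h x y)).trans hy.symm

end Realization

end RipsSpanier
end

noncomputable section
namespace RipsSpanier

open Realization unitInterval

/-! ### Geodesics -/

section Geodesic

variable {X : Type u} [MetricSpace X]

theorem IsGeodesicSpace.exists_path (hX : IsGeodesicSpace X) (x y : X) :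
    ∃ γ : Path x y, ∀ t : I, dist x (γ t) = t * dist x y ∧ dist (γ t) y = (1 - t) * dist x y := by
  obtain ⟨γ, hγ, h0, h1⟩ := hX x y
  have hd : (0 : ℝ) ≤ dist x y := dist_nonneg
  have hmem : ∀ t : I, (t : ℝ) * dist x y ∈ Set.Icc (0 : ℝ) (dist x y) := fun t =>
    ⟨mul_nonneg t.2.1 hd, mul_le_of_le_one_left hd t.2.2⟩
  refine ⟨⟨⟨fun t => γ ⟨t * dist x y, hmem t⟩, hγ.continuous.comp (by fun_prop)⟩, ?_, ?_⟩,
    fun t => ⟨?_, ?_⟩⟩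
  · simpa using h0
  · simpa using h1
  · nth_rw 1 [← h0]
    refine (hγ.dist_eq _ _).trans ?_
    rw [Subtype.dist_eq, dist_comm, Real.dist_eq, sub_zero, abs_of_nonneg (hmem t).1]
  · refine (congrArg₂ dist rfl h1.symm).trans ((hγ.dist_eq _ _).trans ?_)
    rw [Subtype.dist_eq, dist_comm, Real.dist_eq, abs_of_nonneg (sub_nonneg.mpr (hmem t).2)]
    ring

theorem IsGeodesicSpace.pathConnectedSpace (hX : IsGeodesicSpace X) (x₀ : X) :
    PathConnectedSpace X :=
  ⟨⟨x₀⟩, fun x y => ⟨(hX.exists_path x y).choose⟩⟩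

/-- A choice of a geodesic between two points. -/
def IsGeodesicSpace.path (hX : IsGeodesicSpace X) (x y : X) : Path x y :=
  (hX.exists_path x y).choose

variable (hX : IsGeodesicSpace X)
include hX

theorem IsGeodesicSpace.dist_left (x y : X) (t : I) : dist x (hX.path x y t) = t * dist x y :=
  ((hX.exists_path x y).choose_spec t).1

theorem IsGeodesicSpace.dist_right (x y : X) (t : I) :
    dist (hX.path x y t) y = (1 - t) * dist x y :=
  ((hX.exists_path x y).choose_spec t).2

theorem IsGeodesicSpace.dist_add_dist (x y : X) (t : I) :
    dist x (hX.path x y t) + dist (hX.path x y t) y = dist x y := by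
  rw [hX.dist_left, hX.dist_right]; ring

theorem IsGeodesicSpace.dist_path (x y : X) (s t : I) :
    dist (hX.path x y s) (hX.path x y t) ≤ dist x y := by
  have h1 := hX.dist_add_dist x y s
  have h2 := hX.dist_add_dist x y t
  have h3 := dist_triangle_left (hX.path x y s) (hX.path x y t) x
  have h4 := dist_triangle_right (hX.path x y s) (hX.path x y t) y
  linarith

theorem IsGeodesicSpace.diam_range_path_le (x y : X) :
    Metric.diam (Set.range (hX.path x y)) ≤ dist x y := by
  refine Metric.diam_le_of_forall_dist_le dist_nonneg ?_
  rintro _ ⟨s, rfl⟩ _ ⟨t, rfl⟩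
  exact hX.dist_path x y s t

end Geodesic

/-! ### Edges of the Rips complex -/

section Edges

variable {X : Type u} [MetricSpace X] {r : ℝ} {hr : 0 < r}

theorem mem_rips_iff {s : Finset X} :
    s ∈ (rips X r hr).faces ↔ s.Nonempty ∧ ∀ x ∈ s, ∀ y ∈ s, dist x y < r := by
  refine ⟨fun h => ⟨h.1, fun x hx y hy => (Metric.dist_le_diam_of_mem
    (Finset.finite_toSet s).isBounded hx hy).trans_lt h.2⟩, fun h => ⟨h.1, ?_⟩⟩
  obtain ⟨⟨a, b⟩, hab, hmax⟩ := Finset.exists_max_image (s ×ˢ s) (fun p => dist p.1 p.2)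
    (h.1.product h.1)
  rw [Finset.mem_product] at hab
  exact (Metric.diam_le_of_forall_dist_le dist_nonneg fun x hx y hy =>
    hmax (x, y) (Finset.mem_product.mpr ⟨hx, hy⟩)).trans_lt (h.2 a hab.1 b hab.2)

theorem dist_lt_of_ne_zero (p : Rips X r hr) {x y : X} (hx : p.1 x ≠ 0) (hy : p.1 y ≠ 0) :
    dist x y < r := by
  classical
  have h := mem_faces_of_ne_zero p (t := {x, y}) (Finset.insert_nonempty _ _) (by
    simp only [Finset.mem_insert, Finset.mem_singleton]
    rintro v (rfl | rfl) <;> assumption)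
  exact (mem_rips_iff.mp h).2 x (by simp) y (by simp)

open Classical in
theorem carries_triple {x y z : X} (hxy : dist x y < r) (hyz : dist y z < r) (hxz : dist x z < r) :
    Carries (rips X r hr) {x, y, z} (vertex _ x) (vertex _ y) ∧
      Carries (rips X r hr) {x, y, z} (vertex _ y) (vertex _ z) := by
  have h : ({x, y, z} : Finset X) ∈ (rips X r hr).faces := by
    refine mem_rips_iff.mpr ⟨Finset.insert_nonempty _ _, ?_⟩
    simp only [Finset.mem_insert, Finset.mem_singleton]
    rintro a (rfl | rfl | rfl) b (rfl | rfl | rfl) <;> 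
      first | (rw [dist_self]; exact hr) | assumption | (rw [dist_comm]; assumption)
  refine ⟨⟨h, fun v hv => vertex_apply_ne ?_, fun v hv => vertex_apply_ne ?_⟩,
    ⟨h, fun v hv => vertex_apply_ne ?_, fun v hv => vertex_apply_ne ?_⟩⟩ <;>
  · rintro rfl
    simp at hv

theorem carries_pair {x y : X} (hxy : dist x y < r) :
    ∃ s, Carries (rips X r hr) s (vertex _ x) (vertex _ y) :=
  ⟨_, (carries_triple hxy (by simpa using hr) hxy).1⟩

variable {Q : Type*} [Group Q] (F : PathHom (Rips X r hr) Q)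

open Classical in
/-- The value of a path homomorphism on the edge between two vertices of the Rips complex. -/
def edgeValue (x y : X) : Q := if h : dist x y < r then F (line (carries_pair h)) else 1

theorem edgeValue_eq {x y : X} (h : dist x y < r) :
    edgeValue F x y = F (line (carries_pair h)) := dif_pos h

open Classical in
theorem edgeValue_eq_edge {x y : X} (h : ({x, y} : Finset X) ∈ (rips X r hr).faces) :
    F (edge _ h) = edgeValue F x y := by
  rw [edgeValue_eq F ((mem_rips_iff.mp h).2 x (by simp) y (by simp))]
  exact F.congr _ _ fun t => edge_apply _ h t

theorem edgeValue_mul {x y z : X} (hxy : dist x y < r) (hyz : dist y z < r) (hxz : dist x z < r) :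
    edgeValue F y z * edgeValue F x y = edgeValue F x z := by
  obtain ⟨h1, h2⟩ := carries_triple (hr := hr) hxy hyz hxz
  rw [edgeValue_eq F hxy, edgeValue_eq F hyz, edgeValue_eq F hxz]
  exact line_mul_line F h1 h2

theorem edgeValue_self (x : X) : edgeValue F x x = 1 := by
  have h : dist x x < r := by simpa using hr
  exact left_eq_mul.mp (edgeValue_mul F h h h).symm

theorem edgeValue_symm {x y : X} (h : dist x y < r) : edgeValue F y x = (edgeValue F x y)⁻¹ := by
  refine eq_inv_of_mul_eq_one_left ?_
  rw [edgeValue_mul F h (by rwa [dist_comm]) (by simpa using hr), edgeValue_self]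

/-- The path homomorphism sends a path in `X` to the product of the edges of its `r`-samples. -/
def IsSampleHom (Φ : PathHom X Q) : Prop :=
  ∀ {x y : X} (γ : Path x y), Metric.diam (Set.range γ) < r → Φ γ = edgeValue F x y

/-- Points at mutual distance `< r` span a simplex, which is the cocycle identity for `edgeValue`.
-/
theorem exists_isSampleHom : ∃ Φ : PathHom X Q, IsSampleHom F Φ := by
  -- All open sets with mutual distances `< r` are admitted, not only balls, so that a neighbourhood
  -- of any path of diameter `< r` belongs to the cover.
  let 𝒰 : Set (Set X) := {U | IsOpen U ∧ ∀ x ∈ U, ∀ y ∈ U, dist x y < r}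
  have hc : IsLocalCocycle 𝒰 (edgeValue F) := by
    refine ⟨fun U hU => hU.1, fun p => ⟨Metric.ball p (r / 2), ⟨Metric.isOpen_ball, ?_⟩,
      Metric.mem_ball_self (half_pos hr)⟩, fun U hU p hp q hq s hs =>
      edgeValue_mul F (hU.2 p hp q hq) (hU.2 q hq s hs) (hU.2 p hp s hs)⟩
    intro x hx y hy
    rw [Metric.mem_ball] at hx hy
    linarith [dist_triangle_right x y p]
  obtain ⟨Φ, hΦ⟩ := hc.exists_pathHom
  refine ⟨Φ, fun {x y} γ hγ => ?_⟩
  -- Thickening by `δ` adds less than `2 * δ` to distances, exactly the room left below `r`.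
  let δ := (r - Metric.diam (Set.range γ)) / 2
  have hδ : 0 < δ := half_pos (sub_pos.mpr hγ)
  refine hΦ (Metric.thickening δ (Set.range γ)) ⟨Metric.isOpen_thickening, ?_⟩ γ
    (Metric.self_subset_thickening hδ _)
  intro a ha b hb
  obtain ⟨a', ha', haa⟩ := Metric.mem_thickening_iff.mp ha
  obtain ⟨b', hb', hbb⟩ := Metric.mem_thickening_iff.mp hb
  have h1 := Metric.dist_le_diam_of_mem (isCompact_range γ.continuous).isBounded ha' hb'
  have h2 := dist_triangle4 a a' b' b
  rw [dist_comm b' b] at h2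
  simp only [δ] at haa hbb
  linarith

/-- Small balls form a cover whose members have diameter less than a given bound. -/
theorem diam_range_lt_of_subset_ball {x y p : X} {γ : Path x y} {ε : ℝ} (hε : 0 < ε)
    (h : Set.range γ ⊆ Metric.ball p (ε / 3)) : Metric.diam (Set.range γ) < ε :=
  ((Metric.diam_mono h Metric.isBounded_ball).trans
    (Metric.diam_ball (by positivity))).trans_lt (by linarith)

/-- Two path homomorphisms on a metric space agree up to a coboundary if they do so on paths
of small diameter. -/
theorem PathHom.eq_of_eq_of_diam_lt {Φ Φ' : PathHom X Q} (b : X → Q) {ε : ℝ} (hε : 0 < ε)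
    {x y : X} (γ : Path x y)
    (h : ∀ s t : I, Metric.diam (Set.range (γ.subpath s t)) < ε →
      Φ (γ.subpath s t) = b (γ t) * Φ' (γ.subpath s t) * (b (γ s))⁻¹) :
    Φ γ = b y * Φ' γ * (b x)⁻¹ := by
  refine Φ.eq_of_locally_eq Φ' b γ (Set.range fun p => Metric.ball p (ε / 3)) ?_ ?_ ?_
  · rintro _ ⟨p, rfl⟩
    exact Metric.isOpen_ball
  · exact fun t => ⟨_, ⟨γ t, rfl⟩, Metric.mem_ball_self (by positivity)⟩
  · rintro s t - _ ⟨p, rfl⟩ hs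
    exact h s t (diam_range_lt_of_subset_ball hε hs)

theorem dist_le_diam_range {x y : X} (γ : Path x y) (s t : I) :
    dist (γ s) (γ t) ≤ Metric.diam (Set.range γ) :=
  Metric.dist_le_diam_of_mem (isCompact_range γ.continuous).isBounded ⟨s, rfl⟩ ⟨t, rfl⟩

theorem dist_endpoints_le_diam_range {x y : X} (γ : Path x y) :
    dist x y ≤ Metric.diam (Set.range γ) := by
  simpa using dist_le_diam_range γ 0 1

variable {F}

/-- A sample homomorphism vanishes on loops in closed balls of radius less than `3r/2`. -/
theorem IsSampleHom.eq_one (hX : IsGeodesicSpace X) {Φ : PathHom X Q} (hΦ : IsSampleHom F Φ)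
    {y w : X} {d : ℝ} (hd : d < 3 * r / 2) (β : Path y y)
    (hβ : Set.range β ⊆ Metric.closedBall w d) : Φ β = 1 := by
  have hd0 : 0 ≤ d := dist_nonneg.trans (Metric.mem_closedBall.mp (hβ ⟨0, rfl⟩))
  -- The fraction `2/3` balances two constraints: `w` to `c p` costs at most `2d/3`, and the detour
  -- `c p`, `p`, `q`, `c q` costs at most `2d/3` plus `dist p q`. Both fit below `r` because `d <
  -- 3r/2`.
  let c : X → X := fun p => hX.path w p ⟨2 / 3, by norm_num, by norm_num⟩
  have hc1 : ∀ p ∈ Metric.closedBall w d, dist w (c p) ≤ 2 * d / 3 := fun p hp => by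
    rw [Metric.mem_closedBall'] at hp
    simp only [c, hX.dist_left]
    linarith
  have hc2 : ∀ p ∈ Metric.closedBall w d, dist (c p) p ≤ d / 3 := fun p hp => by
    rw [Metric.mem_closedBall'] at hp
    simp only [c, hX.dist_right]
    linarith
  -- Comparison with the trivial homomorphism exhibits `Φ` as a coboundary along `β`, hence trivial
  -- on a closed path. The bound `r - 2d/3` is the room left for `dist p q`.
  have h := PathHom.eq_of_eq_of_diam_lt (Φ := Φ) (Φ' := 1)
    (fun p => edgeValue F (c p) p * edgeValue F w (c p)) (ε := r - 2 * d / 3) (by linarith) β ?_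
  · rw [h]
    exact (congrArg (· * _) (mul_one _)).trans (mul_inv_cancel _)
  intro s t hst
  have hs := hβ ⟨s, rfl⟩
  have ht := hβ ⟨t, rfl⟩
  have hpq := (dist_endpoints_le_diam_range (β.subpath s t)).trans_lt hst
  rw [hΦ _ (hst.trans_le (by linarith))]
  have h1 := hc1 _ hs
  have h2 := hc2 _ hs
  have h3 := hc1 _ ht
  have h4 := hc2 _ ht
  have h5 := dist_triangle (c (β s)) (β s) (β t)
  have h6 := dist_triangle4 (c (β s)) (β s) (β t) (c (β t))
  rw [dist_comm (β t) (c (β t))] at h6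
  -- Three triangles fill the strip between `w` and the piece of `β`: with `p = β s` and `q = β t`,
  -- they are `(c p, p, q)`, `(c p, c q, q)` and `(w, c p, c q)`.
  have e1 := edgeValue_mul F (x := c (β s)) (y := β s) (z := β t) (by linarith)
    (by linarith) (by linarith)
  have e2 := edgeValue_mul F (x := c (β s)) (y := c (β t)) (z := β t) (by linarith) (by linarith)
    (by linarith)
  have e3 := edgeValue_mul F (x := w) (y := c (β s)) (z := c (β t)) (by linarith) (by linarith)
    (by linarith)
  refine eq_mul_inv_of_mul_eq ?_
  refine Eq.trans ?_ (mul_one _).symm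
  rw [← mul_assoc, e1, ← e2, mul_assoc, e3]

end Edges

end RipsSpanier
end

noncomputable section
namespace RipsSpanier

open Realization unitInterval

/-! ### From the Rips complex back to the space -/

section GeodesicHom

variable {X : Type u} [MetricSpace X] {A : Type*} [Group A]

/-- A path homomorphism vanishes on loops in closed balls of radius less than `R`. -/
def VanishesOnBalls (U : PathHom X A) (R : ℝ) : Prop :=
  ∀ {y w : X} {d : ℝ}, d < R → ∀ β : Path y y, Set.range β ⊆ Metric.closedBall w d → U β = 1

variable {r : ℝ} {hr : 0 < r} {U : PathHom X A} (hU : VanishesOnBalls U (3 * r / 2))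
  (hX : IsGeodesicSpace X)

section

include hU

/-- Going round the triangle the shorter way, every point is within half the perimeter of `x`, and
half the perimeter is `< 3r/2`. -/
theorem VanishesOnBalls.geodesic_mul {x y z : X} (hxy : dist x y < r) (hyz : dist y z < r)
    (hxz : dist x z < r) :
    U (hX.path y z) * U (hX.path x y) = U (hX.path x z) := by
  have h := hU (w := x) (d := (dist x y + dist y z + dist x z) / 2) (by linarith)
    (((hX.path x y).trans (hX.path y z)).trans (hX.path x z).symm) ?_
  · rw [PathHom.trans_apply, PathHom.trans_apply, PathHom.symm_apply, inv_mul_eq_one] at h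
    exact h.symm
  rw [Path.trans_range, Path.trans_range, Path.symm_range]
  rintro _ ((⟨t, rfl⟩ | ⟨t, rfl⟩) | ⟨t, rfl⟩) <;> rw [Metric.mem_closedBall']
  · have h1 := hX.dist_add_dist x y t
    have h2 : 0 ≤ dist (hX.path x y t) y := dist_nonneg
    linarith [dist_triangle_right x y z]
  · have h1 := hX.dist_add_dist y z t
    have h2 := dist_triangle x y (hX.path y z t)
    have h3 := dist_triangle_right x (hX.path y z t) z
    linarith
  · have h1 := hX.dist_add_dist x z t
    have h2 : 0 ≤ dist (hX.path x z t) z := dist_nonneg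
    linarith [dist_triangle x y z]

theorem VanishesOnBalls.geodesic_self (hr : 0 < r) (x : X) : U (hX.path x x) = 1 := by
  have h : dist x x < r := by simpa using hr
  exact left_eq_mul.mp (hU.geodesic_mul hX h h h).symm

/-- The path followed by the reversed geodesic is a loop in the ball about `x` whose radius is the
diameter of the path. -/
theorem VanishesOnBalls.apply_eq_geodesic (hr : 0 < r) {x y : X} (γ : Path x y)
    (hγ : Metric.diam (Set.range γ) < r) : U γ = U (hX.path x y) := by
  have h := hU (w := x) (d := Metric.diam (Set.range γ)) (by linarith)
    (γ.trans (hX.path x y).symm) ?_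
  · rw [PathHom.trans_apply, PathHom.symm_apply, inv_mul_eq_one] at h
    exact h.symm
  rw [Path.trans_range, Path.symm_range]
  rintro _ (⟨t, rfl⟩ | ⟨t, rfl⟩) <;> rw [Metric.mem_closedBall']
  · simpa using dist_le_diam_range γ 0 t
  · have h1 := hX.dist_add_dist x y t
    have h2 : 0 ≤ dist (hX.path x y t) y := dist_nonneg
    linarith [dist_endpoints_le_diam_range γ]

end

/-- A vertex of the carrier of a point of the Rips complex. -/
def nearVertex (p : Rips X r hr) : X := (exists_ne_zero p).choose

theorem nearVertex_ne_zero (p : Rips X r hr) : p.1 (nearVertex p) ≠ 0 :=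
  (exists_ne_zero p).choose_spec

theorem nearVertex_vertex (x : X) : nearVertex (vertex (rips X r hr) x) = x := by
  by_contra h
  exact nearVertex_ne_zero _ (vertex_apply_ne h)

/-- A path homomorphism on the Rips complex sends edges to geodesics. -/
def IsGeodesicHom (U : PathHom X A) (Ψ : PathHom (Rips X r hr) A) : Prop :=
  ∀ (u : X) {p q : Rips X r hr} (γ : Path p q), Set.range γ ⊆ openStar _ u →
    Ψ γ = U (hX.path u (nearVertex q)) * U (hX.path (nearVertex p) u)

include hU in
-- Points of a common open star are joined through its centre `u`. The result does not depend on
-- `u`, by two geodesic triangles; within one star the visits to `u` cancel, which is the cocycle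
-- identity.
theorem VanishesOnBalls.exists_isGeodesicHom :
    ∃ Ψ : PathHom (Rips X r hr) A, IsGeodesicHom hX U Ψ := by
  classical
  let c : Rips X r hr → Rips X r hr → A := fun p q =>
    if h : ∃ u, p ∈ openStar _ u ∧ q ∈ openStar _ u then
      U (hX.path h.choose (nearVertex q)) * U (hX.path (nearVertex p) h.choose) else 1
  have hc : ∀ (u : X) (p q : Rips X r hr), p ∈ openStar _ u → q ∈ openStar _ u →
      c p q = U (hX.path u (nearVertex q)) * U (hX.path (nearVertex p) u) := by
    intro u p q hp hq
    have h : ∃ u, p ∈ openStar _ u ∧ q ∈ openStar _ u := ⟨u, hp, hq⟩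
    obtain ⟨hp', hq'⟩ := h.choose_spec
    refine (dif_pos h).trans ?_
    generalize h.choose = w at hp' hq'
    have h1 := dist_lt_of_ne_zero p hp' hp
    have h2 := dist_lt_of_ne_zero p (nearVertex_ne_zero p) hp
    have h3 := dist_lt_of_ne_zero p (nearVertex_ne_zero p) hp'
    have h4 := dist_lt_of_ne_zero q hq (nearVertex_ne_zero q)
    have h5 := dist_lt_of_ne_zero q hq' (nearVertex_ne_zero q)
    rw [← hU.geodesic_mul hX h1 h4 h5, mul_assoc,
      hU.geodesic_mul hX h3 h1 h2]
  have hcoc : IsLocalCocycle (Set.range (openStar (rips X r hr))) c := by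
    refine ⟨?_, fun p => ⟨_, ⟨_, rfl⟩, nearVertex_ne_zero p⟩, ?_⟩
    · rintro _ ⟨u, rfl⟩
      exact isOpen_openStar u
    · rintro _ ⟨u, rfl⟩ p hp q hq s hs
      rw [hc u p q hp hq, hc u q s hq hs, hc u p s hp hs]
      have h1 := dist_lt_of_ne_zero q hq (nearVertex_ne_zero q)
      have h2 := dist_lt_of_ne_zero q (nearVertex_ne_zero q) hq
      have h := hU.geodesic_mul hX h1 h2 (by simpa using hr)
      rw [hU.geodesic_self hX hr] at h
      rw [mul_assoc, ← mul_assoc (U (hX.path (nearVertex q) u)), h, one_mul]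
  obtain ⟨Ψ, hΨ⟩ := hcoc.exists_pathHom
  refine ⟨Ψ, fun u p q γ hγ => ?_⟩
  rw [hΨ _ ⟨u, rfl⟩ γ hγ, hc u p q (hγ ⟨0, γ.source⟩) (hγ ⟨1, γ.target⟩)]

include hU in
-- The edge is cut at its midpoint, so that one half lies in the star of `x` and the other in the
-- star of `y`. The chosen vertex of the midpoint is `x` or `y`, and in either case only one
-- geodesic survives.
theorem VanishesOnBalls.edgeValue_eq {Ψ : PathHom (Rips X r hr) A} (hΨ : IsGeodesicHom hX U Ψ)
    {x y : X} (hxy : dist x y < r) : edgeValue Ψ x y = U (hX.path x y) := by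
  rw [RipsSpanier.edgeValue_eq Ψ hxy]
  let ℓ := line (carries_pair (hr := hr) hxy)
  let h : I := ⟨1 / 2, by norm_num, by norm_num⟩
  change Ψ ℓ = _
  have h0 : ℓ 0 = vertex _ x := ℓ.source
  have h1 : ℓ 1 = vertex _ y := ℓ.target
  have hℓ : ∀ (t : I) (v : X), (ℓ t).1 v =
      (1 - (t : ℝ)) * (vertex (rips X r hr) x).1 v + t * (vertex (rips X r hr) y).1 v :=
    fun t v => line_apply _ t v
  have hx : Set.range (ℓ.subpath 0 h) ⊆ openStar _ x := by
    rw [Path.range_subpath_of_le _ _ _ h.2.1]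
    rintro _ ⟨t, ht, rfl⟩
    have ht2 : (t : ℝ) ≤ 1 / 2 := ht.2
    have h2 : 0 ≤ (t : ℝ) * (vertex (rips X r hr) y).1 x := mul_nonneg t.2.1 ((vertex _ y).2.1 x)
    refine ne_of_gt ?_
    rw [hℓ, vertex_apply_self]
    linarith
  have hy : Set.range (ℓ.subpath h 1) ⊆ openStar _ y := by
    rw [Path.range_subpath_of_le _ _ _ h.2.2]
    rintro _ ⟨t, ht, rfl⟩
    have ht2 : 1 / 2 ≤ (t : ℝ) := ht.1
    have h2 : 0 ≤ (1 - (t : ℝ)) * (vertex (rips X r hr) x).1 y :=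
      mul_nonneg (sub_nonneg.mpr t.2.2) ((vertex _ x).2.1 y)
    refine ne_of_gt ?_
    rw [hℓ, vertex_apply_self]
    linarith [ht2, h2]
  have hm : nearVertex (ℓ h) = x ∨ nearVertex (ℓ h) = y := by
    by_contra hne
    rw [not_or] at hne
    refine nearVertex_ne_zero (ℓ h) ?_
    rw [hℓ, vertex_apply_ne hne.1, vertex_apply_ne hne.2]
    simp
  rw [← Ψ.subpath_zero_one, ← Ψ.subpath_mul_subpath ℓ 0 h 1, hΨ x _ hx, hΨ y _ hy, h0, h1,
    nearVertex_vertex, nearVertex_vertex, hU.geodesic_self hX hr,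
    hU.geodesic_self hX hr, one_mul, mul_one]
  have hself : ∀ z : X, dist z z < r := fun z => by simpa using hr
  rcases hm with hm | hm <;> rw [hm, hU.geodesic_self hX hr]
  · rw [mul_one]
  · rw [one_mul]

theorem IsSampleHom.apply_geodesic {F : PathHom (Rips X r hr) A} {Φ : PathHom X A}
    (hΦ : IsSampleHom F Φ) {x y : X} (h : dist x y < r) : Φ (hX.path x y) = edgeValue F x y :=
  hΦ _ ((hX.diam_range_path_le x y).trans_lt h)

/-- A path homomorphism on the Rips complex is determined, up to a coboundary, by the associated
path homomorphism on the space. -/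
theorem IsGeodesicHom.apply_eq {F : PathHom (Rips X r hr) A}
    (b : X → A) (hUF : ∀ x y, dist x y < r → U (hX.path x y) = b y * edgeValue F x y * (b x)⁻¹)
    {Ψ : PathHom (Rips X r hr) A} (hΨ : IsGeodesicHom hX U Ψ) {p q : Rips X r hr} (γ : Path p q) :
    Ψ γ = b (nearVertex q) * F (line (carries_vertex (nearVertex_ne_zero q))) * F γ *
      (b (nearVertex p) * F (line (carries_vertex (nearVertex_ne_zero p))))⁻¹ := by
  refine Ψ.eq_of_locally_eq F
    (fun p => b (nearVertex p) * F (line (carries_vertex (nearVertex_ne_zero p)))) γ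
    (Set.range (openStar (rips X r hr))) ?_ 
    (fun t => ⟨_, ⟨nearVertex (γ t), rfl⟩, nearVertex_ne_zero _⟩) ?_
  · rintro _ ⟨u, rfl⟩
    exact isOpen_openStar u
  rintro s t - _ ⟨u, rfl⟩ hst
  have hs := hst ⟨0, (γ.subpath s t).source⟩
  have ht := hst ⟨1, (γ.subpath s t).target⟩
  -- The segment from `p` to `u` may be replaced by one through `nearVertex p`, since all three
  -- points lie in the carrier of `p`.
  have key : ∀ {p : Rips X r hr} (hp : p ∈ openStar (rips X r hr) u),
      F (line (carries_vertex hp)) =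
        edgeValue F (nearVertex p) u * F (line (carries_vertex (nearVertex_ne_zero p))) := by
    intro p hp
    have h := dist_lt_of_ne_zero p (nearVertex_ne_zero p) hp
    obtain ⟨s, hs, hps, -⟩ := p.2.2
    have hv : ∀ x, p.1 x ≠ 0 → ∀ v ∉ s, (vertex (rips X r hr) x).1 v = 0 := fun x hx v hv =>
      vertex_apply_ne fun h => hx (hps x (h ▸ hv))
    rw [edgeValue_eq F h]
    exact (line_mul_line F (s := s) ⟨hs, hps, hv _ (nearVertex_ne_zero p)⟩
      ⟨hs, hv _ (nearVertex_ne_zero p), hv _ hp⟩).symm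
  have h1 := dist_lt_of_ne_zero _ (nearVertex_ne_zero (γ s)) hs
  have h2 := dist_lt_of_ne_zero _ (nearVertex_ne_zero (γ t)) ht
  rw [hΨ u _ hst, apply_of_range_subset_openStar F _ hst hs ht, key hs, key ht,
    hUF _ _ h1, hUF _ _ (by rwa [dist_comm]), edgeValue_symm F h2]
  group

end GeodesicHom

end RipsSpanier
end

noncomputable section
namespace RipsSpanier

open Realization unitInterval

/-! ### Samples -/

section Samples

variable {X : Type u} [MetricSpace X] {r : ℝ} {hr : 0 < r} {Q : Type*} [Group Q]
  {F : PathHom (Rips X r hr) Q} {Φ : PathHom X Q}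

open Classical in
theorem IsSampleHom.edgePath_apply (hΦ : IsSampleHom F Φ) {x y : X} (α : Path x y) {n : ℕ}
    (t : Fin (n + 1) → I)
    (ht : ∀ i : Fin n, Metric.diam (Set.range (α.subpath (t i.castSucc) (t i.succ))) < r)
    (h : ∀ i : Fin n, ({α (t i.castSucc), α (t i.succ)} : Finset X) ∈ (rips X r hr).faces) :
    F (edgePath (rips X r hr) (fun i => α (t i)) h) = Φ (α.subpath (t 0) (t (Fin.last n))) := by
  induction n with
  | zero =>
    refine (F.refl_apply _).trans ?_
    exact ((congrArg Φ.toFun (Path.subpath_self α (t 0))).trans (Φ.refl_apply _)).symm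
  | succ n ih =>
    rw [← Φ.subpath_mul_subpath α (t 0) (t (Fin.last n).castSucc)]
    refine (F.trans_apply _ _).trans (congrArg₂ (· * ·) ?_
      (ih (fun i => t i.castSucc) (fun i => ht i.castSucc) fun i => h i.castSucc))
    refine (edgeValue_eq_edge F _).trans ?_
    exact (hΦ _ (ht (Fin.last n))).symm

/-- The value of a path homomorphism on the loop of a sample. -/
theorem IsSampleHom.loop_apply (hΦ : IsSampleHom F Φ) {x : X} {α : Path x x} (s : Sample α r) :
    F (s.loop hr) = Φ (α.subpath 0 (s.t 0)) * Φ α * (Φ (α.subpath 0 (s.t 0)))⁻¹ := by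
  classical
  -- The closing edge of the sample is the value of the arc through the base point, made of the end
  -- of `α` and then its beginning. As the sample starts at `α (t 0)`, the result is a conjugate of
  -- `Φ α`.
  let δ₁ : Path (α (s.t (Fin.last s.m))) x :=
    (α.subpath (s.t (Fin.last s.m)) 1).cast rfl α.target.symm
  let δ₂ : Path x (α (s.t 0)) := (α.subpath 0 (s.t 0)).cast α.source.symm rfl
  have hδ : Metric.diam (Set.range (δ₁.trans δ₂)) < r := by
    have h1 : Set.range δ₁ = α '' Set.Icc (s.t (Fin.last s.m)) 1 :=
      Path.range_subpath_of_le _ _ _ (s.t _).2.2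
    have h2 : Set.range δ₂ = α '' Set.Icc 0 (s.t 0) :=
      Path.range_subpath_of_le _ _ _ (s.t _).2.1
    rw [Path.trans_range, h1, h2, Set.union_comm, ← Set.image_union]
    exact s.diam_wrap_lt
  have h1 := hΦ _ hδ
  have h2 := hΦ.edgePath_apply α s.t (fun i => by
    rw [Path.range_subpath_of_le _ _ _ (s.strictMono.monotone i.castSucc_lt_succ.le)]
    exact s.diam_lt i) (fun i => pair_mem_rips hr ((isCompact_Icc.image α.continuous).isBounded)
      (s.diam_lt i) ⟨_, Set.left_mem_Icc.mpr (s.strictMono.monotone i.castSucc_lt_succ.le), rfl⟩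
      ⟨_, Set.right_mem_Icc.mpr (s.strictMono.monotone i.castSucc_lt_succ.le), rfl⟩)
  have h3 : F (s.loop hr) = edgeValue F (α (s.t (Fin.last s.m))) (α (s.t 0)) *
      Φ (α.subpath (s.t 0) (s.t (Fin.last s.m))) := by
    rw [← h2]
    refine (F.trans_apply _ _).trans (congrArg (· * _) ?_)
    exact edgeValue_eq_edge F _
  rw [h3, ← h1, PathHom.trans_apply, PathHom.cast_apply, PathHom.cast_apply, ← Φ.subpath_zero_one α,
    ← Φ.subpath_mul_subpath α 0 (s.t 0) 1,
    ← Φ.subpath_mul_subpath α (s.t 0) (s.t (Fin.last s.m)) 1]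
  group

/-- Every loop has samples starting at the base point. -/
theorem exists_sample {x : X} (α : Path x x) {r : ℝ} (hr : 0 < r) :
    ∃ s : Sample α r, s.t 0 = 0 := by
  have huc : UniformContinuous α := CompactSpace.uniformContinuous_of_continuous α.continuous
  obtain ⟨δ, hδ, h⟩ := Metric.uniformContinuous_iff.mp huc (r / 2) (half_pos hr)
  obtain ⟨n, hn⟩ := exists_nat_one_div_lt hδ
  have hn0 : (0 : ℝ) < n + 1 := by positivity
  -- The subdivision deliberately omits `1`: the last interval, from `n/(n+1)` to `1`, is the
  -- wrap-around arc.
  let t : Fin (n + 1) → I := fun i => ⟨i / (n + 1), by positivity, by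
    rw [div_le_one hn0]
    exact_mod_cast i.2.le⟩
  have hsmall : ∀ a b : I, a ≤ b → (b : ℝ) ≤ a + 1 / (n + 1) →
      Metric.diam (α '' Set.Icc a b) < r := by
    intro a b hab hb
    refine (Metric.diam_le_of_forall_dist_le (half_pos hr).le ?_).trans_lt (half_lt_self hr)
    rintro _ ⟨p, hp, rfl⟩ _ ⟨q, hq, rfl⟩
    refine (h ?_).le
    have h1 : (a : ℝ) ≤ p := hp.1
    have h2 : (p : ℝ) ≤ b := hp.2
    have h3 : (a : ℝ) ≤ q := hq.1
    have h4 : (q : ℝ) ≤ b := hq.2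
    rw [Subtype.dist_eq, Real.dist_eq, abs_lt]
    constructor <;> linarith
  have ht : StrictMono t := by
    intro i j hij
    refine Subtype.mk_lt_mk.mpr ?_
    have : (i : ℝ) < j := by exact_mod_cast hij
    gcongr
  have ht0 : t 0 = 0 := Subtype.ext (by simp [t])
  refine ⟨⟨n, t, ht, fun i => hsmall _ _ (ht i.castSucc_lt_succ).le ?_, ?_⟩, ht0⟩
  · simp only [t, Fin.val_succ, Fin.val_castSucc]
    push_cast
    rw [add_div]
  · have h0 : α '' (Set.Icc 0 (t 0) ∪ Set.Icc (t (Fin.last n)) 1) =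
        α '' Set.Icc (t (Fin.last n)) 1 := by
      rw [ht0, Set.Icc_self, Set.image_union]
      refine Set.union_eq_self_of_subset_left ?_
      rw [Set.image_singleton, Set.singleton_subset_iff, α.source]
      exact ⟨1, Set.right_mem_Icc.mpr (t _).2.2, α.target⟩
    rw [h0]
    refine hsmall _ _ (t _).2.2 ?_
    simp only [t, Fin.val_last, Set.Icc.coe_one]
    rw [← add_div, div_self hn0.ne']

/-- A sample at a scale is a sample at every larger scale. -/
def Sample.mono {x : X} {α : Path x x} {p q : ℝ} (hpq : p < q) (s : Sample α p) : Sample α q where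
  m := s.m
  t := s.t
  strictMono := s.strictMono
  diam_lt i := (s.diam_lt i).trans hpq
  diam_wrap_lt := s.diam_wrap_lt.trans hpq

open Classical in
theorem map_edgePath {V : Type u} {K L : AbstractSimplicialComplex V} (h : K ≤ L) {n : ℕ}
    (x : Fin (n + 1) → V) (hK : ∀ i : Fin n, ({x i.castSucc, x i.succ} : Finset V) ∈ K.faces) :
    (edgePath K x hK).map (incl h).continuous = edgePath L x fun i => h (hK i) := by
  induction n with
  | zero => rfl
  | succ n ih =>
    refine (Path.map_trans _ _ _).trans ?_
    exact congrArg (Path.trans · _) (ih (fun i => x i.castSucc) fun i => hK i.castSucc)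

theorem Sample.map_loop {x : X} {α : Path x x} {p q : ℝ} (hp : 0 < p) (hpq : p < q)
    (s : Sample α p) :
    (s.loop hp).map (bonding X hp hpq).continuous = (s.mono hpq).loop (hp.trans hpq) := by
  refine (Path.map_trans _ _ _).trans ?_
  exact congrArg (Path.trans · _) (map_edgePath (rips_mono X hp hpq) _ _)

end Samples

/-! ### The isomorphism of fundamental groups -/

section Pi

variable {X : Type u} [MetricSpace X]

/-- Vertices are joined by edges along a finely subdivided geodesic; `path_induction` is applied to
a property of the endpoints alone. -/
theorem Rips.pathConnectedSpace (hX : IsGeodesicSpace X) (x₀ : X) {r : ℝ} (hr : 0 < r) :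
    PathConnectedSpace (Rips X r hr) := by
  have : Nonempty X := ⟨x₀⟩
  refine joined_of_joined_vertices fun x y => ?_
  refine path_induction (P := fun {p q} _ => Joined (vertex (rips X r hr) p) (vertex _ q))
    (fun _ h => h) (fun _ _ h h' => h.trans h') (hX.path x y)
    (Set.range fun p => Metric.ball p (r / 3)) ?_
    (fun t => ⟨_, ⟨_, rfl⟩, Metric.mem_ball_self (by positivity)⟩) ?_
  · rintro _ ⟨p, rfl⟩
    exact Metric.isOpen_ball
  · rintro s t - _ ⟨p, rfl⟩ hst
    exact ⟨line (carries_pair ((dist_endpoints_le_diam_range _).trans_lt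
      (diam_range_lt_of_subset_ball hr hst)))⟩

theorem PathHom.toMonoidHom_loopClass {Y : Type u} [TopologicalSpace Y] {Q : Type*} [Group Q]
    (F : PathHom Y Q) {y : Y} (α : Path y y) : F.toMonoidHom y (loopClass α) = F α := rfl

theorem PathHom.toMonoidHom_ofBasePaths {Y : Type u} [TopologicalSpace Y] {Q : Type*} [Group Q]
    (F : PathHom Y Q) {y₀ : Y} (C : ∀ p, Path y₀ p) {p q : Y} (γ : Path p q) :
    F.toMonoidHom y₀ (PathHom.ofBasePaths C γ) = (F (C q))⁻¹ * F γ * F (C p) := by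
  refine (F.trans_apply _ _).trans ?_
  rw [F.symm_apply, F.trans_apply, mul_assoc]

theorem PathHom.ofBasePaths_loopClass {Y : Type u} [TopologicalSpace Y] {y₀ : Y}
    (C : ∀ p, Path y₀ p) (hC : C y₀ = Path.refl y₀) (γ : Path y₀ y₀) :
    PathHom.ofBasePaths C γ = loopClass γ :=
  PathHom.ofBasePaths_loop C hC γ

/-- The path homomorphism to the quotient by the Spanier group vanishes on small balls. -/
theorem vanishesOnBalls_spanierPi {x₀ : X} (C : ∀ p, Path x₀ p) (R : ℝ) :
    VanishesOnBalls ((PathHom.ofBasePaths C).comp (QuotientGroup.mk' (spanierPi X x₀ R))) R :=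
  fun {y w d} hd β hβ => (QuotientGroup.eq_one_iff _).mpr
    (Subgroup.subset_closure ⟨y, w, d, C y, β, hd, hβ, rfl⟩)

/-- `Φ` and `Ψ` induce mutually inverse maps on loops. `Φ` is returned as well, because homology
requires its values on loops not based at `x₀`. -/
theorem exists_piEquiv (hX : IsGeodesicSpace X) (x₀ : X) {r : ℝ} (hr : 0 < r)
    (D : ∀ p, Path (vertex (rips X r hr) x₀) p) (hD : D (vertex _ x₀) = Path.refl _) :
    ∃ (e : (FundamentalGroup X x₀ ⧸ spanierPi X x₀ (3 * r / 2)) ≃*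
        FundamentalGroup (Rips X r hr) (vertex _ x₀))
      (Φ : PathHom X (FundamentalGroup (Rips X r hr) (vertex _ x₀))),
      IsSampleHom (PathHom.ofBasePaths D) Φ ∧
        ∀ α : Path x₀ x₀, e (QuotientGroup.mk (loopClass α)) = Φ α := by
  have := hX.pathConnectedSpace x₀
  obtain ⟨C, hC⟩ := exists_basePaths x₀
  obtain ⟨Φ, hΦ⟩ := exists_isSampleHom (PathHom.ofBasePaths D)
  let U := (PathHom.ofBasePaths C).comp (QuotientGroup.mk' (spanierPi X x₀ (3 * r / 2)))
  have hU : VanishesOnBalls U (3 * r / 2) := vanishesOnBalls_spanierPi C _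
  obtain ⟨Ψ, hΨ⟩ := hU.exists_isGeodesicHom (hr := hr) hX
  have hker : spanierPi X x₀ (3 * r / 2) ≤ (Φ.toMonoidHom x₀).ker := by
    refine (Subgroup.closure_le _).mpr ?_
    rintro _ ⟨y, w, d, α, β, hd, hβ, rfl⟩
    refine MonoidHom.mem_ker.mpr ?_
    rw [PathHom.toMonoidHom_loopClass, Φ.trans_apply, Φ.trans_apply, hΦ.eq_one hX hd β hβ,
      Φ.symm_apply, one_mul, inv_mul_cancel]
  let φ := QuotientGroup.lift _ (Φ.toMonoidHom x₀) hker
  let ψ := Ψ.toMonoidHom (vertex _ x₀)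
  have hUα : ∀ α : Path x₀ x₀, U α = QuotientGroup.mk (loopClass α) := fun α =>
    congrArg _ (PathHom.ofBasePaths_loopClass C hC α)
  -- On short paths `ψ ∘ Φ` is `U` conjugated by values of `Ψ` on the base paths `D`; these are
  -- trivial at the base point.
  have h1 : ∀ α : Path x₀ x₀, ψ (Φ α) = QuotientGroup.mk (loopClass α) := by
    intro α
    have h := PathHom.eq_of_eq_of_diam_lt (Φ := Φ.comp ψ) (Φ' := U)
      (fun x => (Ψ (D (vertex _ x)))⁻¹) hr α fun s t hst => by
        have hlt := (dist_endpoints_le_diam_range _).trans_lt hst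
        change ψ (Φ (α.subpath s t)) = _
        rw [hΦ _ hst, edgeValue_eq _ hlt, hU.apply_eq_geodesic hX hr _ hst,
          ← hU.edgeValue_eq hX hΨ hlt, edgeValue_eq _ hlt, inv_inv]
        exact PathHom.toMonoidHom_ofBasePaths _ _ _
    rw [← hUα]
    refine h.trans ?_
    rw [hD, Ψ.refl_apply]
    simp
  -- Here the values of `Φ` on the base paths `C` provide the coboundary, again trivial at `x₀`.
  have h2 : ∀ γ : Path (vertex (rips X r hr) x₀) (vertex _ x₀), φ (Ψ γ) = loopClass γ := by
    intro γ
    have hUF : ∀ x y, dist x y < r → (U.comp φ) (hX.path x y) =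
        (Φ (C y))⁻¹ * edgeValue (PathHom.ofBasePaths D) x y * ((Φ (C x))⁻¹)⁻¹ := by
      intro x y hxy
      rw [inv_inv, ← hΦ.apply_geodesic hX hxy]
      exact PathHom.toMonoidHom_ofBasePaths _ _ _
    have h := IsGeodesicHom.apply_eq (U := U.comp φ) hX (fun x => (Φ (C x))⁻¹) hUF
      (Ψ := Ψ.comp φ) (fun u p q γ hγ => (congrArg φ (hΨ u γ hγ)).trans (map_mul φ _ _)) γ
    refine h.trans ?_
    have hv := nearVertex_vertex (hr := hr) x₀
    have hline : ∀ (x : X) (h : ∃ s, Carries (rips X r hr) s (vertex _ x₀) (vertex _ x)), x = x₀ →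
        (PathHom.ofBasePaths D) (line h) = 1 := by
      rintro x h rfl
      have hx : dist x x < r := by simpa using hr
      exact (edgeValue_eq _ hx).symm.trans (edgeValue_self _ _)
    rw [hline _ _ hv, hv, hC, Φ.refl_apply, PathHom.ofBasePaths_loopClass D hD, inv_one,
      one_mul, one_mul, inv_one, mul_one]
  refine ⟨MulEquiv.ofBijective φ ⟨?_, ?_⟩, Φ, hΦ, fun α => rfl⟩
  · refine Function.LeftInverse.injective (g := ψ) fun a => ?_
    obtain ⟨a, rfl⟩ := QuotientGroup.mk_surjective a
    obtain ⟨α, rfl⟩ := Path.Homotopic.Quotient.mk_surjective a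
    exact h1 α
  · intro b
    obtain ⟨γ, rfl⟩ := Path.Homotopic.Quotient.mk_surjective b
    exact ⟨Ψ γ, h2 γ⟩

end Pi

end RipsSpanier
end

noncomputable section
namespace RipsSpanier

/-! ### Singular chains of dimension at most two -/

section SingularChains

open unitInterval Simplicial

variable {Y : Type u} [TopologicalSpace Y]

/-- A continuous map from a standard simplex as a singular simplex. -/
def toSingular {n : ℕ} (f : C(stdSimplex ℝ (Fin (n + 1)), Y)) :
    (TopCat.toSSet.obj (TopCat.of Y)) _⦋n⦌ :=
  (TopCat.toSSetObjEquiv (TopCat.of Y) (.op ⦋n⦌)).symm f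

theorem toSingular_surjective {n : ℕ} :
    Function.Surjective (toSingular : C(stdSimplex ℝ (Fin (n + 1)), Y) → _) :=
  (TopCat.toSSetObjEquiv (TopCat.of Y) (.op ⦋n⦌)).symm.surjective

theorem toSingular_injective {n : ℕ} :
    Function.Injective (toSingular : C(stdSimplex ℝ (Fin (n + 1)), Y) → _) :=
  (TopCat.toSSetObjEquiv (TopCat.of Y) (.op ⦋n⦌)).symm.injective

/-- The inclusion of a face of the standard simplex. -/
def faceMap {n : ℕ} (i : Fin (n + 2)) :
    C(stdSimplex ℝ (Fin (n + 1)), stdSimplex ℝ (Fin (n + 2))) :=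
  ⟨_, stdSimplex.continuous_map i.succAbove⟩

theorem faceMap_apply_succAbove {n : ℕ} (i : Fin (n + 2)) (w : stdSimplex ℝ (Fin (n + 1)))
    (k : Fin (n + 1)) : (faceMap i w).1 (i.succAbove k) = w.1 k := by
  refine (FunOnFinite.linearMap_apply_apply ℝ ℝ i.succAbove w.1 _).trans ?_
  rw [Finset.sum_eq_single_of_mem k (by simp)]
  simp only [Finset.mem_filter, Finset.mem_univ, true_and, Fin.succAbove_right_inj]
  exact fun j hj h => absurd hj h

theorem faceMap_apply_self {n : ℕ} (i : Fin (n + 2)) (w : stdSimplex ℝ (Fin (n + 1))) :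
    (faceMap i w).1 i = 0 := by
  refine (FunOnFinite.linearMap_apply_apply ℝ ℝ i.succAbove w.1 _).trans ?_
  exact Finset.sum_eq_zero fun j hj => by simp at hj

theorem δ_toSingular {n : ℕ} (f : C(stdSimplex ℝ (Fin (n + 2)), Y)) (i : Fin (n + 2)) :
    (TopCat.toSSet.obj (TopCat.of Y)).δ i (toSingular f) = toSingular (f.comp (faceMap i)) := rfl

/-- The singular `1`-simplex given by a map from the unit interval. -/
def arcSimplex (γ : C(I, Y)) : (TopCat.toSSet.obj (TopCat.of Y)) _⦋1⦌ :=
  toSingular (γ.comp (toContinuousMap stdSimplexHomeomorphUnitInterval))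

/-- A map from the standard `1`-simplex as a map from the unit interval. -/
def arc (f : C(stdSimplex ℝ (Fin 2), Y)) : C(I, Y) :=
  f.comp (toContinuousMap stdSimplexHomeomorphUnitInterval.symm)

theorem arcSimplex_arc (f : C(stdSimplex ℝ (Fin 2), Y)) : arcSimplex (arc f) = toSingular f := by
  refine congrArg toSingular (ContinuousMap.ext fun w => ?_)
  exact congrArg f (stdSimplexHomeomorphUnitInterval.symm_apply_apply w)

theorem exists_arcSimplex_eq (s : (TopCat.toSSet.obj (TopCat.of Y)) _⦋1⦌) :
    ∃ γ : C(I, Y), arcSimplex γ = s := by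
  obtain ⟨f, rfl⟩ := toSingular_surjective s
  exact ⟨arc f, arcSimplex_arc f⟩

theorem arcSimplex_injective : Function.Injective (arcSimplex : C(I, Y) → _) := fun γ δ h => by
  ext t
  have h' := DFunLike.congr_fun (toSingular_injective h) (stdSimplexHomeomorphUnitInterval.symm t)
  simpa using h'

/-- A point as a singular `0`-simplex. -/
def pointSimplex (y : Y) : (TopCat.toSSet.obj (TopCat.of Y)) _⦋0⦌ :=
  toSingular (ContinuousMap.const _ y)

theorem δ_arcSimplex_zero (γ : C(I, Y)) :
    (TopCat.toSSet.obj (TopCat.of Y)).δ 0 (arcSimplex γ) = pointSimplex (γ 1) := by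
  have h (w : stdSimplex ℝ (Fin 1)) : stdSimplexHomeomorphUnitInterval (faceMap 0 w) = 1 :=
    Subtype.ext ((faceMap_apply_succAbove 0 w 0).trans (by simpa using w.2.2))
  have e : (γ.comp (toContinuousMap stdSimplexHomeomorphUnitInterval)).comp (faceMap 0) =
      ContinuousMap.const _ (γ 1) := ContinuousMap.ext fun w => congrArg γ (h w)
  exact congrArg toSingular e

theorem δ_arcSimplex_one (γ : C(I, Y)) :
    (TopCat.toSSet.obj (TopCat.of Y)).δ 1 (arcSimplex γ) = pointSimplex (γ 0) := by
  have h (w : stdSimplex ℝ (Fin 1)) : stdSimplexHomeomorphUnitInterval (faceMap 1 w) = 0 :=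
    Subtype.ext (faceMap_apply_self 1 w)
  have e : (γ.comp (toContinuousMap stdSimplexHomeomorphUnitInterval)).comp (faceMap 1) =
      ContinuousMap.const _ (γ 0) := ContinuousMap.ext fun w => congrArg γ (h w)
  exact congrArg toSingular e

variable (G : Type v) [AddCommGroup G]

/-- The class of a singular `1`-simplex modulo boundaries, with a coefficient. -/
def arcClass (γ : C(I, Y)) : AddCommGrpCat.of (ULift.{u} G) ⟶ (singularChains Y G).opcycles 1 :=
  SSet.ιChainComplex _ (arcSimplex γ) ≫ (singularChains Y G).pOpcycles 1

theorem ι_toSingular_d (f : C(stdSimplex ℝ (Fin 3), Y)) :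
    SSet.ιChainComplex _ (toSingular f) ≫ (singularChains Y G).d 2 1 =
      SSet.ιChainComplex _ (arcSimplex (arc (f.comp (faceMap 0)))) -
        SSet.ιChainComplex _ (arcSimplex (arc (f.comp (faceMap 1)))) +
        SSet.ιChainComplex _ (arcSimplex (arc (f.comp (faceMap 2)))) := by
  rw [SSet.ιChainComplex_d]
  simp only [δ_toSingular, ← arcSimplex_arc]
  erw [Fin.sum_univ_three]
  simp [sub_eq_add_neg]

theorem ι_arcSimplex_d (γ : C(I, Y)) :
    SSet.ιChainComplex _ (arcSimplex γ) ≫ (singularChains Y G).d 1 0 =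
      SSet.ιChainComplex _ (pointSimplex (γ 1)) - SSet.ιChainComplex _ (pointSimplex (γ 0)) := by
  rw [SSet.ιChainComplex_d]
  erw [Fin.sum_univ_two]
  rw [← δ_arcSimplex_zero, ← δ_arcSimplex_one]
  simp [sub_eq_add_neg]

/-- The alternating sum of the faces is a boundary, so it dies in the opcycles. -/
theorem arcClass_add_of_triangle (f : C(stdSimplex ℝ (Fin 3), Y)) :
    arcClass G (arc (f.comp (faceMap 2))) + arcClass G (arc (f.comp (faceMap 0))) =
      arcClass G (arc (f.comp (faceMap 1))) := by
  have h : (SSet.ιChainComplex _ (toSingular f) ≫ (singularChains Y G).d 2 1) ≫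
      (singularChains Y G).pOpcycles 1 = 0 := by
    rw [Category.assoc, HomologicalComplex.d_pOpcycles, Limits.comp_zero]
  rw [ι_toSingular_d, Preadditive.add_comp, Preadditive.sub_comp] at h
  simp only [arcClass]
  rw [← sub_eq_zero, ← h]
  abel

/-! ### Relations among arcs modulo boundaries -/

section Segment

variable {E : Type*} [AddCommGroup E] [Module ℝ E] [TopologicalSpace E] [ContinuousAdd E]
  [ContinuousSMul ℝ E]

/-- The restriction of a continuous map to the segment between two points. -/
def segmentMap (F : C(E, Y)) (a b : E) : C(I, Y) :=
  F.comp ⟨fun t => (1 - (t : ℝ)) • a + (t : ℝ) • b, by fun_prop⟩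

theorem segmentMap_apply (F : C(E, Y)) (a b : E) (t : I) :
    segmentMap F a b t = F ((1 - (t : ℝ)) • a + (t : ℝ) • b) := rfl

/-- The affine triangle with vertices `a`, `b`, `c` is a singular 2-simplex. It may be degenerate,
so this one relation covers constant arcs, homotopies and concatenation. -/
theorem arcClass_segmentMap_add (F : C(E, Y)) (a b c : E) :
    arcClass G (segmentMap F a b) + arcClass G (segmentMap F b c) =
      arcClass G (segmentMap F a c) := by
  let f : C(stdSimplex ℝ (Fin 3), Y) := F.comp
    ⟨fun w => w.1 0 • a + w.1 1 • b + w.1 2 • c, by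
      have h (i : Fin 3) : Continuous fun w : stdSimplex ℝ (Fin 3) => w.1 i :=
        (continuous_apply i).comp continuous_subtype_val
      exact (((h 0).smul continuous_const).add ((h 1).smul continuous_const)).add
        ((h 2).smul continuous_const)⟩
  have hc (i : Fin 3) (t : I) (k : Fin 2) :
      (faceMap i (stdSimplexHomeomorphUnitInterval.symm t)).1 (i.succAbove k) =
        ![1 - (t : ℝ), t] k := faceMap_apply_succAbove i _ k
  have hs (i : Fin 3) (t : I) :
      (faceMap i (stdSimplexHomeomorphUnitInterval.symm t)).1 i = 0 := faceMap_apply_self i _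
  have h := arcClass_add_of_triangle G f
  have h2 : arc (f.comp (faceMap 2)) = segmentMap F a b := by
    ext t
    refine congrArg F ?_
    have e₁ := hc 2 t 0
    have e₂ := hc 2 t 1
    have e₃ := hs 2 t
    change _ • a + _ • b + _ • c = _
    simp only [show Fin.succAbove (2 : Fin 3) 0 = 0 from rfl,
      show Fin.succAbove (2 : Fin 3) 1 = 1 from rfl] at e₁ e₂
    refine (congrArg₂ _ (congrArg₂ _ (congrArg (· • a) e₁) (congrArg (· • b) e₂))
      (congrArg (· • c) e₃)).trans ?_
    simp
  have h0 : arc (f.comp (faceMap 0)) = segmentMap F b c := by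
    ext t
    refine congrArg F ?_
    have e₁ := hc 0 t 0
    have e₂ := hc 0 t 1
    have e₃ := hs 0 t
    change _ • a + _ • b + _ • c = _
    simp only [show Fin.succAbove (0 : Fin 3) 0 = 1 from rfl,
      show Fin.succAbove (0 : Fin 3) 1 = 2 from rfl] at e₁ e₂
    refine (congrArg₂ _ (congrArg₂ _ (congrArg (· • a) e₃) (congrArg (· • b) e₁))
      (congrArg (· • c) e₂)).trans ?_
    simp
  have h1 : arc (f.comp (faceMap 1)) = segmentMap F a c := by
    ext t
    refine congrArg F ?_
    have e₁ := hc 1 t 0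
    have e₂ := hc 1 t 1
    have e₃ := hs 1 t
    change _ • a + _ • b + _ • c = _
    simp only [show Fin.succAbove (1 : Fin 3) 0 = 0 from rfl,
      show Fin.succAbove (1 : Fin 3) 1 = 2 from rfl] at e₁ e₂
    refine (congrArg₂ _ (congrArg₂ _ (congrArg (· • a) e₁) (congrArg (· • b) e₃))
      (congrArg (· • c) e₂)).trans ?_
    simp
  rwa [h0, h1, h2] at h

theorem arcClass_const (y : Y) : arcClass G (ContinuousMap.const I y) = 0 := by
  have h := arcClass_segmentMap_add G (ContinuousMap.const ℝ y) 0 0 0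
  exact left_eq_add.mp h.symm

end Segment

theorem arcClass_eq_of_homotopic {p q : Y} {γ δ : Path p q} (h : γ.Homotopic δ) :
    arcClass G γ.toContinuousMap = arcClass G δ.toContinuousMap := by
  obtain ⟨H⟩ := h
  -- The homotopy is extended to the plane by projection so that it has affine triangles; the unit
  -- square is then cut along its diagonal.
  let F : C(ℝ × ℝ, Y) := (H : C(I × I, Y)).comp
    ⟨fun w => (Set.projIcc 0 1 zero_le_one w.1, Set.projIcc 0 1 zero_le_one w.2), by
      fun_prop⟩
  have h1 := arcClass_segmentMap_add G F (0, 0) (0, 1) (1, 1)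
  have h2 := arcClass_segmentMap_add G F (0, 0) (1, 0) (1, 1)
  have e1 : segmentMap F (0, 0) (0, 1) = γ.toContinuousMap := by
    ext t
    simp [segmentMap_apply, F]
  have e2 : segmentMap F (1, 0) (1, 1) = δ.toContinuousMap := by
    ext t
    simp [segmentMap_apply, F]
  have e3 : segmentMap F (0, 0) (1, 0) = ContinuousMap.const I p := by
    ext t
    simp [segmentMap_apply, F]
  have e4 : segmentMap F (0, 1) (1, 1) = ContinuousMap.const I q := by
    ext t
    simp [segmentMap_apply, F]
  rw [e1, e4, arcClass_const, add_zero] at h1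
  rw [e2, e3, arcClass_const, zero_add] at h2
  rw [h1, h2]

theorem arcClass_trans {p q s : Y} (γ : Path p q) (δ : Path q s) :
    arcClass G (γ.trans δ).toContinuousMap =
      arcClass G δ.toContinuousMap + arcClass G γ.toContinuousMap := by
  let F : C(ℝ, Y) := ⟨(γ.trans δ).extend, (γ.trans δ).continuous_extend⟩
  have h := arcClass_segmentMap_add G F 0 (1 / 2) 1
  have e1 : segmentMap F 0 (1 / 2) = γ.toContinuousMap := by
    ext t
    have h1 := t.2.2
    have e : (1 - (t : ℝ)) • (0 : ℝ) + (t : ℝ) • (1 / 2 : ℝ) = t / 2 := by simp; ring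
    have ht : (t : ℝ) / 2 ∈ I := ⟨by linarith [t.2.1], by linarith⟩
    rw [segmentMap_apply, e]
    refine ((γ.trans δ).extend_apply ht).trans ?_
    rw [Path.trans_apply, dif_pos (show (t : ℝ) / 2 ≤ 1 / 2 by linarith)]
    exact congrArg γ (Subtype.ext (show 2 * ((t : ℝ) / 2) = t by ring))
  have e2 : segmentMap F (1 / 2) 1 = δ.toContinuousMap := by
    ext t
    have h0 := t.2.1
    have e : (1 - (t : ℝ)) • (1 / 2 : ℝ) + (t : ℝ) • (1 : ℝ) = (1 + t) / 2 := by simp; ring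
    have ht : (1 + (t : ℝ)) / 2 ∈ I := ⟨by linarith, by linarith [t.2.2]⟩
    rw [segmentMap_apply, e]
    refine ((γ.trans δ).extend_apply ht).trans ?_
    rw [Path.trans_apply]
    split_ifs with h
    · have h2 : (1 + (t : ℝ)) / 2 ≤ 1 / 2 := h
      obtain rfl : t = 0 := Subtype.ext (le_antisymm (show (t : ℝ) ≤ 0 by linarith) h0)
      refine (congrArg γ (Subtype.ext ?_)).trans (γ.target.trans δ.source.symm)
      norm_num
    · exact congrArg δ (Subtype.ext (show 2 * ((1 + (t : ℝ)) / 2) - 1 = t by ring))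
  have e3 : segmentMap F 0 1 = (γ.trans δ).toContinuousMap := by
    ext t
    simp [segmentMap_apply, F]
  rw [← e1, ← e2, ← e3, add_comm, h]

variable (Y) in
/-- The class of a path modulo boundaries, as a path homomorphism. -/
def pathClass : PathHom Y (Multiplicative
    (AddCommGrpCat.of (ULift.{u} G) ⟶ (singularChains Y G).opcycles 1)) where
  toFun γ := .ofAdd (arcClass G γ.toContinuousMap)
  map_homotopic h := congrArg _ (arcClass_eq_of_homotopic G h)
  map_trans γ δ := congrArg _ (arcClass_trans G γ δ)

/-- The class of a loop in homology, as a homomorphism in the coefficient. -/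
def loopHomology {y : Y} (α : Path y y) :
    AddCommGrpCat.of (ULift.{u} G) ⟶ (singularChains Y G).homology 1 :=
  (singularChains Y G).liftCycles (loopChain α G) 0 (by simp) (loopChain_d α G) ≫
    (singularChains Y G).homologyπ 1

theorem loopHom_apply {y : Y} (α : Path y y) (g : G) :
    loopHom α G g = (loopHomology G α).hom ⟨g⟩ := rfl

/-- As `homologyι` is a monomorphism, identities between homology classes of loops can be checked on
`pathClass`. -/
theorem loopHomology_homologyι {y : Y} (α : Path y y) :
    loopHomology G α ≫ (singularChains Y G).homologyι 1 = (pathClass Y G α).toAdd := by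
  refine (Category.assoc _ _ _).trans ?_
  rw [HomologicalComplex.homology_π_ι, ← Category.assoc, HomologicalComplex.liftCycles_i]
  rfl

/-- The path traced by a map from the unit interval. -/
def arcPath (γ : C(I, Y)) : Path (γ 0) (γ 1) := ⟨γ, rfl, rfl⟩

/-! ### Homomorphisms out of chains and homology -/

section Desc

variable {G} {A : AddCommGrpCat.{max u v}}

theorem exists_chainsDesc (φ : C(I, Y) → (AddCommGrpCat.of (ULift.{u} G) ⟶ A)) :
    ∃ Ψ : (singularChains Y G).X 1 ⟶ A,
      ∀ γ, SSet.ιChainComplex _ (arcSimplex γ) ≫ Ψ = φ γ := by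
  refine ⟨Limits.Cofan.IsColimit.desc (SSet.isColimitChainComplexXCofan _ _ 1)
    fun s => φ (exists_arcSimplex_eq s).choose, fun γ => ?_⟩
  refine (Limits.Cofan.IsColimit.fac (SSet.isColimitChainComplexXCofan _ _ 1) _ _).trans ?_
  exact congrArg φ (arcSimplex_injective (exists_arcSimplex_eq (arcSimplex γ)).choose_spec)

theorem exists_pointsDesc (φ : Y → (AddCommGrpCat.of (ULift.{u} G) ⟶ A)) :
    ∃ Ψ : (singularChains Y G).X 0 ⟶ A,
      ∀ y, SSet.ιChainComplex _ (pointSimplex y) ≫ Ψ = φ y := by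
  refine ⟨Limits.Cofan.IsColimit.desc (SSet.isColimitChainComplexXCofan _ _ 0)
    fun s => φ ((toSingular_surjective s).choose ⟨_, single_mem_stdSimplex ℝ 0⟩), fun y => ?_⟩
  refine (Limits.Cofan.IsColimit.fac (SSet.isColimitChainComplexXCofan _ _ 0) _ _).trans ?_
  rw [toSingular_injective (toSingular_surjective (pointSimplex y)).choose_spec]
  rfl

theorem singularChains_hom_ext {f g : (singularChains Y G).X 1 ⟶ A}
    (h : ∀ γ : C(I, Y), SSet.ιChainComplex _ (arcSimplex γ) ≫ f =
      SSet.ιChainComplex _ (arcSimplex γ) ≫ g) : f = g := by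
  refine SSet.chainComplex_hom_ext fun s => ?_
  obtain ⟨γ, rfl⟩ := exists_arcSimplex_eq s
  exact h γ

end Desc

theorem stdSimplexHomeomorphUnitInterval_symm_zero :
    stdSimplexHomeomorphUnitInterval.symm 0 = stdSimplex.vertex 0 := by
  rw [Homeomorph.symm_apply_eq]
  apply Subtype.ext
  simp

theorem stdSimplexHomeomorphUnitInterval_symm_one :
    stdSimplexHomeomorphUnitInterval.symm 1 = stdSimplex.vertex 1 := by
  rw [Homeomorph.symm_apply_eq]
  apply Subtype.ext
  simp

/-- An edge of the standard `2`-simplex. -/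
def edgeOfTriangle (i : Fin 3) : Path (stdSimplex.vertex (S := ℝ) (i.succAbove 0))
    (stdSimplex.vertex (S := ℝ) (i.succAbove 1)) :=
  ⟨arc (faceMap i),
    (congrArg (faceMap i) stdSimplexHomeomorphUnitInterval_symm_zero).trans
      (stdSimplex.map_vertex _ _),
    (congrArg (faceMap i) stdSimplexHomeomorphUnitInterval_symm_one).trans
      (stdSimplex.map_vertex _ _)⟩

theorem PathHom.map_triangle {Q : Type*} [Group Q] (F : PathHom Y Q)
    (f : C(stdSimplex ℝ (Fin 3), Y)) :
    F (arcPath (arc (f.comp (faceMap 0)))) * F (arcPath (arc (f.comp (faceMap 2)))) =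
      F (arcPath (arc (f.comp (faceMap 1)))) := by
  have : ContractibleSpace (stdSimplex ℝ (Fin 3)) :=
    (convex_stdSimplex ℝ (Fin 3)).contractibleSpace ⟨_, single_mem_stdSimplex ℝ 0⟩
  let γ₀₁ : Path (stdSimplex.vertex (S := ℝ) (0 : Fin 3)) (stdSimplex.vertex 1) :=
    edgeOfTriangle 2
  let γ₁₂ : Path (stdSimplex.vertex (S := ℝ) (1 : Fin 3)) (stdSimplex.vertex 2) :=
    edgeOfTriangle 0
  let γ₀₂ : Path (stdSimplex.vertex (S := ℝ) (0 : Fin 3)) (stdSimplex.vertex 2) :=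
    edgeOfTriangle 1
  have h := (F.comap f).eq_of_simplyConnected (γ₀₁.trans γ₁₂) γ₀₂
  rw [PathHom.trans_apply] at h
  rw [F.congr (arcPath (arc (f.comp (faceMap 0)))) (γ₁₂.map f.continuous) fun _ => rfl,
    F.congr (arcPath (arc (f.comp (faceMap 1)))) (γ₀₂.map f.continuous) fun _ => rfl,
    F.congr (arcPath (arc (f.comp (faceMap 2)))) (γ₀₁.map f.continuous) fun _ => rfl]
  exact h

variable {G} in
/-- A path homomorphism to the homomorphisms `G →+ A` extends to the first homology group. -/
theorem exists_homologyDesc {A : Type max u v} [AddCommGroup A]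
    (F : PathHom Y (Multiplicative (G →+ A))) :
    ∃ T : H₁ Y G →+ A, ∀ {y : Y} (α : Path y y) (g : G),
      T (loopHom α G g) = (F α).toAdd g := by
  obtain ⟨Ψ, hΨ⟩ := exists_chainsDesc (A := AddCommGrpCat.of A) fun γ : C(I, Y) =>
    AddCommGrpCat.ofHom ((F (arcPath γ)).toAdd.comp AddEquiv.ulift.toAddMonoidHom)
  -- A 2-simplex is simply connected, so `F` is multiplicative along its sides; hence `Ψ` vanishes
  -- on boundaries and descends to the opcycles.
  have hd : (singularChains Y G).d 2 1 ≫ Ψ = 0 := by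
    refine SSet.chainComplex_hom_ext fun s => ?_
    obtain ⟨f, rfl⟩ := toSingular_surjective s
    have h : (SSet.ιChainComplex _ (toSingular f) ≫ (singularChains Y G).d 2 1) ≫ Ψ = 0 := by
      rw [ι_toSingular_d, Preadditive.add_comp, Preadditive.sub_comp, hΨ, hΨ, hΨ,
        ← F.map_triangle f]
      ext g
      simp
    exact (Category.assoc _ _ _).symm.trans (h.trans Limits.comp_zero.symm)
  refine ⟨((singularChains Y G).homologyι 1 ≫
    (singularChains Y G).descOpcycles Ψ 2 (by simp) hd).hom, fun α g => ?_⟩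
  have h : loopHomology G α ≫ (singularChains Y G).homologyι 1 ≫
      (singularChains Y G).descOpcycles Ψ 2 (by simp) hd =
      AddCommGrpCat.ofHom ((F α).toAdd.comp AddEquiv.ulift.toAddMonoidHom) := by
    rw [← Category.assoc, loopHomology_homologyι]
    refine (Category.assoc _ _ _).trans ?_
    rw [HomologicalComplex.p_descOpcycles]
    refine (hΨ _).trans ?_
    rw [F.congr (arcPath α.toContinuousMap) α fun _ => rfl]
  exact ConcreteCategory.congr_hom h ⟨g⟩

/-- Homomorphisms from the first homology group of a path connected space agree if they agree on
loops at the basepoint. -/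
theorem homology_hom_ext {y₀ : Y} (C : ∀ p, Path y₀ p) {A : Type max u v} [AddCommGroup A]
    {T T' : H₁ Y G →+ A}
    (h : ∀ (α : Path y₀ y₀) (g : G), T (loopHom α G g) = T' (loopHom α G g)) : T = T' := by
  let loop (γ : C(I, Y)) : Path y₀ y₀ := ((C (γ 0)).trans (arcPath γ)).trans (C (γ 1)).symm
  obtain ⟨Ψ, hΨ⟩ := exists_chainsDesc fun γ : C(I, Y) => loopHomology G (loop γ)
  obtain ⟨κ, hκ⟩ := exists_pointsDesc fun p => -(pathClass Y G (C p)).toAdd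
  -- Closing each arc up with base paths changes its class only by a term factoring through `d`,
  -- which vanishes on cycles. So every homology class is a combination of based loops.
  have h1 : Ψ ≫ (singularChains Y G).homologyι 1 =
      (singularChains Y G).pOpcycles 1 + (singularChains Y G).d 1 0 ≫ κ := by
    refine singularChains_hom_ext fun γ => ?_
    rw [Preadditive.comp_add, ← Category.assoc, hΨ, loopHomology_homologyι,
      ← Category.assoc, ι_arcSimplex_d, Preadditive.sub_comp, hκ, hκ,
      PathHom.trans_apply, PathHom.trans_apply, PathHom.symm_apply, toAdd_mul, toAdd_mul,
      toAdd_inv]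
    change _ = (pathClass Y G (arcPath γ)).toAdd + _
    abel
  have h2 : (singularChains Y G).iCycles 1 ≫ Ψ = (singularChains Y G).homologyπ 1 := by
    rw [← cancel_mono ((singularChains Y G).homologyι 1), Category.assoc, h1,
      Preadditive.comp_add, ← Category.assoc, HomologicalComplex.iCycles_d, Limits.zero_comp,
      add_zero, HomologicalComplex.homology_π_ι]
  let T₁ : (singularChains Y G).homology 1 ⟶ AddCommGrpCat.of A := AddCommGrpCat.ofHom T
  let T₁' : (singularChains Y G).homology 1 ⟶ AddCommGrpCat.of A := AddCommGrpCat.ofHom T'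
  have h3 : Ψ ≫ T₁ = Ψ ≫ T₁' := by
    refine singularChains_hom_ext fun γ => ?_
    rw [← Category.assoc, ← Category.assoc, hΨ]
    ext g
    exact h (loop γ) g.down
  have h4 : T₁ = T₁' := by
    rw [← cancel_epi ((singularChains Y G).homologyπ 1), ← h2, Category.assoc, Category.assoc, h3]
  exact congrArg AddCommGrpCat.Hom.hom h4

theorem H₁map_loopHom {Z : Type u} [TopologicalSpace Z] (f : C(Y, Z)) {y : Y} (α : Path y y)
    (g : G) : H₁map f G (loopHom α G g) = loopHom (α.map f.continuous) G g := by
  let φ := SSet.chainComplexMap (TopCat.toSSet.map (TopCat.ofHom f))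
    (AddCommGrpCat.of (ULift.{u} G))
  have h : loopHomology G α ≫ HomologicalComplex.homologyMap φ 1 =
      loopHomology G (α.map f.continuous) := by
    refine (Category.assoc _ _ _).trans ?_
    rw [HomologicalComplex.homologyπ_naturality, ← Category.assoc,
      HomologicalComplex.liftCycles_comp_cyclesMap]
    have : loopChain α G ≫ φ.f 1 = loopChain (α.map f.continuous) G :=
      SSet.ι_chainComplexMap_f (TopCat.toSSet.obj (TopCat.of Y)) _ _ _ (loopSimplex α)
    simp only [loopHomology, this]
  exact ConcreteCategory.congr_hom h ⟨g⟩

end SingularChains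

end RipsSpanier
end

noncomputable section
namespace RipsSpanier

/-! ### The Hurewicz homomorphism with coefficients -/

section Hurewicz

variable {Y : Type u} [TopologicalSpace Y] (G : Type v) [AddCommGroup G]

theorem loopHom_eq_of_pathClass_eq {x y : Y} {α : Path x x} {β : Path y y}
    (h : pathClass Y G α = pathClass Y G β) : loopHom α G = loopHom β G := by
  have h' : loopHomology G α = loopHomology G β := by
    rw [← cancel_mono ((singularChains Y G).homologyι 1), loopHomology_homologyι,
      loopHomology_homologyι, h]
  ext g
  rw [loopHom_apply, loopHom_apply, h']

theorem loopHom_trans {y : Y} (α β : Path y y) :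
    loopHom (α.trans β) G = loopHom β G + loopHom α G := by
  have h : loopHomology G (α.trans β) = loopHomology G β + loopHomology G α := by
    rw [← cancel_mono ((singularChains Y G).homologyι 1), Preadditive.add_comp,
      loopHomology_homologyι, loopHomology_homologyι, loopHomology_homologyι,
      PathHom.trans_apply, toAdd_mul]
  ext g
  rw [loopHom_apply, h]
  rfl

theorem loopHom_conj {x y : Y} (γ : Path x y) (α : Path y y) :
    loopHom ((γ.trans α).trans γ.symm) G = loopHom α G :=
  loopHom_eq_of_pathClass_eq G (by simp [mul_comm])

/-- The Hurewicz homomorphism with coefficients. -/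
def hurewicz (y : Y) : FundamentalGroup Y y →* Multiplicative (G →+ H₁ Y G) :=
  MonoidHom.mk' (fun c => Quotient.lift (s := Path.Homotopic.setoid y y)
    (fun γ : Path y y => Multiplicative.ofAdd (loopHom γ G))
    (fun _ _ h => congrArg _ (loopHom_eq_of_pathClass_eq G ((pathClass Y G).map_homotopic h))) c)
    fun a b => by
      obtain ⟨a, rfl⟩ := Path.Homotopic.Quotient.mk_surjective a
      obtain ⟨b, rfl⟩ := Path.Homotopic.Quotient.mk_surjective b
      exact congrArg Multiplicative.ofAdd (loopHom_trans G b a)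

/-- Conjugation by a base path disappears in homology, so free loops can be handled at the base
point. -/
theorem hurewicz_ofBasePaths {y₀ : Y} (C : ∀ p, Path y₀ p) {y : Y} (α : Path y y) :
    hurewicz G y₀ (PathHom.ofBasePaths C α) = .ofAdd (loopHom α G) :=
  congrArg Multiplicative.ofAdd (loopHom_conj G (C y) α)

end Hurewicz

theorem exists_loopClass_eq {Y : Type u} [TopologicalSpace Y] {y : Y} (c : FundamentalGroup Y y) :
    ∃ α : Path y y, loopClass α = c :=
  Path.Homotopic.Quotient.mk_surjective c

/-! ### The correspondence -/

section Correspondence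

open Realization

variable {X : Type u} [MetricSpace X]

theorem exists_piEquiv_sample (hX : IsGeodesicSpace X) (x₀ : X) {r : ℝ} (hr : 0 < r) :
    ∃ e : (FundamentalGroup X x₀ ⧸ spanierPi X x₀ (3 * r / 2)) ≃*
        FundamentalGroup (Rips X r hr) (vertex _ x₀),
      ∀ (α : Path x₀ x₀) (s : Sample α r) (hs : s.t 0 = 0),
        e (QuotientGroup.mk (loopClass α)) = loopClass (s.basedLoop hs hr) := by
  have := Rips.pathConnectedSpace hX x₀ hr
  obtain ⟨D, hD⟩ := exists_basePaths (vertex (rips X r hr) x₀)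
  obtain ⟨e, Φ, hΦ, he⟩ := exists_piEquiv hX x₀ hr D hD
  refine ⟨e, fun α s hs => ?_⟩
  have h0 : Φ (α.subpath 0 (s.t 0)) = 1 := by
    rw [hs, Path.subpath_self]
    exact Φ.refl_apply _
  rw [he, ← PathHom.ofBasePaths_loopClass D hD, Sample.basedLoop, PathHom.cast_apply,
    hΦ.loop_apply, h0, one_mul, inv_one, mul_one]

theorem ripsPiBonding_basedLoop (x₀ : X) {p q : ℝ} (hp : 0 < p) (hpq : p < q) {α : Path x₀ x₀}
    (s : Sample α p) (hs : s.t 0 = 0) :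
    ripsPiBonding X x₀ hp hpq (loopClass (s.basedLoop hs hp)) =
      loopClass ((s.mono hpq).basedLoop hs (hp.trans hpq)) := by
  refine (FundamentalGroup.mapOfEq_apply _ _ _).trans ?_
  refine congrArg loopClass (Path.ext (funext fun t => ?_) :
    (((s.basedLoop hs hp).map (bonding X hp hpq).continuous).cast rfl rfl) = _)
  exact DFunLike.congr_fun (s.map_loop hp hpq) t

/-- Both groups receive Hurewicz maps with coefficients. Transporting these along the isomorphism of
fundamental groups gives homomorphisms both ways, and they need only be compared on based loops. -/
theorem exists_homologyEquiv (hX : IsGeodesicSpace X) (x₀ : X) (G : Type v) [AddCommGroup G]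
    {r : ℝ} (hr : 0 < r) :
    ∃ e : (H₁ X G ⧸ spanierH X G (3 * r / 2)) ≃+ H₁ (Rips X r hr) G,
      ∀ (x : X) (α : Path x x) (s : Sample α r) (g : G),
        e (QuotientAddGroup.mk (loopHom α G g)) = loopHom (s.loop hr) G g := by
  have := hX.pathConnectedSpace x₀
  have := Rips.pathConnectedSpace hX x₀ hr
  obtain ⟨C, hC⟩ := exists_basePaths x₀
  obtain ⟨D, hD⟩ := exists_basePaths (vertex (rips X r hr) x₀)
  obtain ⟨e, Φ, hΦ, he⟩ := exists_piEquiv hX x₀ hr D hD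
  set S := spanierH X G (3 * r / 2) with hS
  obtain ⟨T, hT⟩ := exists_homologyDesc (Φ.comp (hurewicz G (vertex (rips X r hr) x₀)))
  have hTS : S ≤ T.ker := by
    rw [hS, spanierH, AddSubgroup.closure_le]
    rintro _ ⟨y, w, d, β, g, hd, hβ, rfl⟩
    refine (hT β g).trans ?_
    change Multiplicative.toAdd (hurewicz G _ (Φ β)) g = 0
    rw [hΦ.eq_one hX hd β hβ, map_one]
    rfl
  -- A generator of `spanierPi` is a lasso, homologous to its small loop, so it dies modulo `S`.
  let A : FundamentalGroup X x₀ →* Multiplicative (G →+ H₁ X G ⧸ S) :=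
    (AddMonoidHom.toMultiplicative (AddMonoidHom.compHom (QuotientAddGroup.mk' S))).comp
      (hurewicz G x₀)
  have hA (c : FundamentalGroup X x₀) (hc : c ∈ spanierPi X x₀ (3 * r / 2)) : A c = 1 := by
    revert c
    change spanierPi X x₀ (3 * r / 2) ≤ A.ker
    rw [spanierPi, Subgroup.closure_le]
    rintro _ ⟨y, w, d, α, β, hd, hβ, rfl⟩
    refine Multiplicative.toAdd.injective (AddMonoidHom.ext fun g => ?_)
    change (QuotientAddGroup.mk (loopHom ((α.trans β).trans α.symm) G g) : H₁ X G ⧸ S) = 0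
    rw [loopHom_conj, QuotientAddGroup.eq_zero_iff]
    exact AddSubgroup.subset_closure ⟨y, w, d, β, g, hd, hβ, rfl⟩
  let A' := QuotientGroup.lift _ A hA
  obtain ⟨T', hT'⟩ := exists_homologyDesc
    (((PathHom.ofBasePaths D).comp e.symm.toMonoidHom).comp A')
  have hT₁ (α : Path x₀ x₀) (β : Path (vertex (rips X r hr) x₀) (vertex (rips X r hr) x₀))
      (h : e (QuotientGroup.mk (loopClass α)) = loopClass β) (g : G) :
      T (loopHom α G g) = loopHom β G g := by
    refine (hT α g).trans ?_
    change Multiplicative.toAdd (hurewicz G _ (Φ α)) g = _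
    rw [← he, h]
    rfl
  have hT₂ (α : Path x₀ x₀) (β : Path (vertex (rips X r hr) x₀) (vertex (rips X r hr) x₀))
      (h : e (QuotientGroup.mk (loopClass α)) = loopClass β) (g : G) :
      T' (loopHom β G g) = QuotientAddGroup.mk (loopHom α G g) := by
    refine (hT' β g).trans ?_
    change Multiplicative.toAdd (A' (e.symm (PathHom.ofBasePaths D β))) g = _
    rw [PathHom.ofBasePaths_loopClass D hD, ← h, e.symm_apply_apply]
    rfl
  let T₀ : H₁ X G ⧸ S →+ H₁ (Rips X r hr) G := QuotientAddGroup.lift S T hTS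
  have hinv₁ : T'.comp T = QuotientAddGroup.mk' S := by
    refine homology_hom_ext G C fun α g => ?_
    obtain ⟨β, hβ⟩ := exists_loopClass_eq (e (QuotientGroup.mk (loopClass α)))
    rw [AddMonoidHom.comp_apply, hT₁ α β hβ.symm, hT₂ α β hβ.symm]
    rfl
  have hinv₂ : T₀.comp T' = AddMonoidHom.id _ := by
    refine homology_hom_ext G D fun β g => ?_
    obtain ⟨a, ha⟩ := QuotientGroup.mk_surjective (e.symm (loopClass β))
    obtain ⟨α, rfl⟩ := exists_loopClass_eq a
    have h : e (QuotientGroup.mk (loopClass α)) = loopClass β := by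
      rw [ha, e.apply_symm_apply]
    rw [AddMonoidHom.comp_apply, hT₂ α β h]
    exact hT₁ α β h g
  refine ⟨AddMonoidHom.toAddEquiv T₀ T' ?_ hinv₂, fun x α s g => ?_⟩
  · refine QuotientAddGroup.addMonoidHom_ext _ ?_
    exact hinv₁
  · refine (hT α g).trans ?_
    -- For a free loop the sample gives a conjugate of `Φ α`; the conjugation is lost in the
    -- commutative target.
    have h : hurewicz G _ (Φ α) = .ofAdd (loopHom (s.loop hr) G) := by
      rw [← hurewicz_ofBasePaths G D, hΦ.loop_apply, map_mul, map_mul, map_inv,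
        mul_inv_cancel_comm]
    exact DFunLike.congr_fun (congrArg Multiplicative.toAdd h) g

end Correspondence

end RipsSpanier

end

open RipsSpanier in
theorem mainTheorem5 {X : Type u} [MetricSpace X] (hX : IsGeodesicSpace X) (x₀ : X)
    (G : Type v) [AddCommGroup G] :
    (∃ e : ∀ (r : ℝ) (hr : 0 < r),
        (FundamentalGroup X x₀ ⧸ spanierPi X x₀ (3 * r / 2)) ≃*
          FundamentalGroup (Rips X r hr) (Realization.vertex _ x₀),
      (∀ (r : ℝ) (hr : 0 < r) (α : Path x₀ x₀) (s : Sample α r) (hs : s.t 0 = 0),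
        e r hr (QuotientGroup.mk (loopClass α)) = loopClass (s.basedLoop hs hr)) ∧
      (∀ (p q : ℝ) (hp : 0 < p) (hpq : p < q)
        (c : FundamentalGroup X x₀ ⧸ spanierPi X x₀ (3 * p / 2)),
        ripsPiBonding X x₀ hp hpq (e p hp c) =
          e q (hp.trans hpq) (spanierPiBonding X x₀ (by linarith) c))) ∧
    (∃ e : ∀ (r : ℝ) (hr : 0 < r),
        (H₁ X G ⧸ spanierH X G (3 * r / 2)) ≃+ H₁ (Rips X r hr) G,
      (∀ (r : ℝ) (hr : 0 < r) (x : X) (α : Path x x) (s : Sample α r) (g : G),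
        e r hr (QuotientAddGroup.mk (loopHom α G g)) = loopHom (s.loop hr) G g) ∧
      (∀ (p q : ℝ) (hp : 0 < p) (hpq : p < q)
        (c : H₁ X G ⧸ spanierH X G (3 * p / 2)),
        ripsHBonding X G hp hpq (e p hp c) =
          e q (hp.trans hpq) (spanierHBonding X G (by linarith) c))) := by
  have := hX.pathConnectedSpace x₀
  constructor
  · choose e he using fun (r : ℝ) (hr : 0 < r) => exists_piEquiv_sample hX x₀ hr
    refine ⟨e, he, fun p q hp hpq c => ?_⟩
    obtain ⟨a, rfl⟩ := QuotientGroup.mk_surjective c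
    obtain ⟨α, rfl⟩ := exists_loopClass_eq a
    -- A single sample at scale `p` computes both sides, since it is also a sample at scale `q`.
    obtain ⟨s, hs⟩ := exists_sample α hp
    rw [he p hp α s hs, ripsPiBonding_basedLoop]
    exact (he q (hp.trans hpq) α (s.mono hpq) hs).symm
  · choose e he using fun (r : ℝ) (hr : 0 < r) => exists_homologyEquiv hX x₀ G hr
    refine ⟨e, he, fun p q hp hpq c => ?_⟩
    obtain ⟨C, -⟩ := exists_basePaths x₀
    obtain ⟨a, rfl⟩ := QuotientAddGroup.mk_surjective c
    -- Homology classes need not be single loops, so the two homomorphisms are compared on all of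
    -- $H_1(X;G)$ by testing based loops.
    have h : ((ripsHBonding X G hp hpq).comp (e p hp).toAddMonoidHom).comp
        (QuotientAddGroup.mk' _) =
        (e q (hp.trans hpq)).toAddMonoidHom.comp (QuotientAddGroup.mk' _) := by
      refine homology_hom_ext G C fun α g => ?_
      obtain ⟨s, hs⟩ := exists_sample α hp
      refine (congrArg (ripsHBonding X G hp hpq) (he p hp x₀ α s g)).trans ?_
      refine (H₁map_loopHom G _ _ g).trans ?_
      rw [Sample.map_loop]
      exact (he q (hp.trans hpq) x₀ α (s.mono hpq) g).symm
    exact DFunLike.congr_fun h a
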